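/- Let $\mathcal X$ be a measurable space with a $\sigma$-finite measure $\nu$, and let $0<\phi<1$, $s>0$. Consider i.i.d. observations $(X_i,Y_i)_{i=1}^n$ from the location-scale model $Y_i=\mu(X_i)+\sigma(X_i)\epsilon_i$, where $X_i$ has density $h$ with respect to $\nu$, $\epsilon_i$ is independent of $X_i$, and $\epsilon_i$ has the asymmetric normal density $$f(y)=\frac{2}{\sqrt{\pi}\,s}\,\frac{\sqrt{\phi(1-\phi)}}{\sqrt{\phi}+\sqrt{1-\phi}}\exp\Big[-\frac{\phi}{s^2}y^2I(y\ge 0)-\frac{1-\phi}{s^2}y^2I(y<0)\Big].$$ Let $\mu\in\mathcal U$, $\sigma\in\Sigma$, $h\in\mathcal H$, where $\mathcal U$ is a uniformly bounded class of measurable functions, $\Sigma$ is a non-empty class of measurable functions with $\overline\sigma^{-1}\le\sigma(x)\le\overline\sigma$ for all $\sigma \in \Sigma$ and $x\in\mathcal X$, for some constant $\overline\sigma>1$, and $\mathcal H$ is a class of probability densities. Suppose that there are $h_0\in\mathcal H$ and $C<\infty$ such that for every $h\in\mathcal H$, $h\le Ch_0$ holds $\nu$-almost everywhere. Write $\|g\|_{2,h}^2=\int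 g^2h\,d\nu$. For a class $\mathcal F$ that is totally bounded in $L_2(h_0)$, let the packing entropy $M_{h_0}(\varepsilon;\mathcal F)$ be the logarithm of the maximal cardinality of a finite subset of $\mathcal F$ whose distinct elements are at $L_2(h_0)$ distance greater than $\varepsilon$. Suppose that $\mathcal U$ and $\Sigma$ are totally bounded in $L_2(h_0)$, that $M_{h_0}(\varepsilon;\Sigma)=O(M_{h_0}(\varepsilon;\mathcal U))$ as $\varepsilon\to0^+$, and that $M_{h_0}(\cdot\,;\mathcal U)$ has a known order $M$, that is $M(\varepsilon)\asymp M_{h_0}(\varepsilon;\mathcal U)$ as $\varepsilon\to0^+$ (for instance $M=M_{h_0}(\cdot\,;\mathcal U)$), which is rich ($\liminf_{\varepsilon\to0^+}M(\alpha\varepsilon)/M(\varepsilon)>1$ for some $0<\alpha<1$) and regular ($M(c\varepsilon)\asymp M(\varepsilon)$ as $\varepsilon\to0^+$ for every $c>0$). Then $\mu(x)$ is the unique $\phi$-th expectile of the conditional distribution of $Y$ given $X=x$, that is, the unique $z$ with $\mathbb E[(z-Y)I(Y\le z)\mid X=x]=\phi\,\mathbb E[|z-Y|\mid X=x]$; and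 the minimax risk for estimating the expectile function $\mu$ satisfies $$\inf_{\hat\mu}\ \sup_{\mu\in\mathcal U,\ \sigma\in\Sigma,\ h\in\mathcal H}\mathbb E\|\mu-\hat\mu\|_{2,h}^2\asymp\varepsilon_n^2\qquad(n\to\infty),$$ where the infimum is over all (jointly measurable) estimators based on the $n$ observations, and $\varepsilon_n>0$ is determined by $M_{h_0}(\varepsilon_n;\mathcal U)=n\varepsilon_n^2$. This holds in each of the following senses: for every sequence $\varepsilon_n>0$ that satisfies this equation for all large $n$; for the crossing point $\varepsilon_n=\inf\{\varepsilon>0: M_{h_0}(\varepsilon;\mathcal U)\le n\varepsilon^2\}$, which always exists for $n \ge 1$ and equals the solution of the equation if there is one; and for every sequence of positive $\varepsilon_n\to0$ with $M(\varepsilon_n)\asymp n\varepsilon_n^2$, in particular with $M(\varepsilon_n)=n\varepsilon_n^2$. -/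

import Mathlib

open MeasureTheory Filter Topology Asymptotics
open scoped ENNReal

noncomputable section

namespace ExpectileMinimax

/-- Density of the asymmetric normal distribution with skewness `φ`, location `η` and scale `s`. -/
def asymNormalPDF (φ η s y : ℝ) : ℝ :=
  2 / (Real.sqrt Real.pi * s) *
    (Real.sqrt (φ * (1 - φ)) / (Real.sqrt φ + Real.sqrt (1 - φ))) *
    Real.exp (-(if η ≤ y then φ / s ^ 2 * (y - η) ^ 2 else (1 - φ) / s ^ 2 * (y - η) ^ 2))

/-- The asymmetric normal distribution with location `0`, as a measure on the real line. -/
def errorLaw (φ s : ℝ) : Measure ℝ :=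
  volume.withDensity fun y => ENNReal.ofReal (asymNormalPDF φ 0 s y)

/-- `z` is a `φ`-th expectile of the distribution `Q`. -/
def IsExpectile (φ : ℝ) (Q : Measure ℝ) (z : ℝ) : Prop :=
  Integrable (fun y : ℝ => y) Q ∧
    ∫ y in Set.Iic z, (z - y) ∂Q = φ * ∫ y, |z - y| ∂Q

section Model

variable {X : Type*} [MeasurableSpace X]

/-- `h` is a probability density with respect to `ν`. -/
structure IsDensity (ν : Measure X) (h : X → ℝ) : Prop where
  measurable : Measurable h
  nonneg : ∀ x, 0 ≤ h x
  lintegral_eq_one : ∫⁻ x, ENNReal.ofReal (h x) ∂ν = 1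

/-- The distribution of the covariate with density `h`. -/
def designLaw (ν : Measure X) (h : X → ℝ) : Measure X :=
  ν.withDensity fun x => ENNReal.ofReal (h x)

/-- Conditional distribution of the response `μ(x) + σ(x) e` given that the covariate is `x`. -/
def responseLaw (φ s : ℝ) (μ σ : X → ℝ) (x : X) : Measure ℝ :=
  (errorLaw φ s).map fun e => μ x + σ x * e

/-- Distribution of one observation `(x, μ(x) + σ(x) e)`, where the covariate `x` has density `h`
and is independent of the asymmetric normal error `e`. -/
def observationLaw (ν : Measure X) (φ s : ℝ) (μ σ h : X → ℝ) : Measure (X × ℝ) :=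
  ((designLaw ν h).prod (errorLaw φ s)).map fun p => (p.1, μ p.1 + σ p.1 * p.2)

/-- Distribution of `n` i.i.d. observations. -/
def sampleLaw (ν : Measure X) (φ s : ℝ) (μ σ h : X → ℝ) (n : ℕ) : Measure (Fin n → X × ℝ) :=
  Measure.pi fun _ => observationLaw ν φ s μ σ h

/-- The `L₂(h)` distance. -/
def l2Dist (ν : Measure X) (h f g : X → ℝ) : ℝ≥0∞ :=
  eLpNorm (fun x => f x - g x) 2 (designLaw ν h)

/-- Expected squared `L₂(h)` loss of the estimator `est`. -/
def risk (ν : Measure X) (φ s : ℝ) (μ σ h : X → ℝ) (n : ℕ)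
    (est : (Fin n → X × ℝ) → X → ℝ) : ℝ≥0∞ :=
  ∫⁻ d, (l2Dist ν h μ (est d)) ^ 2 ∂(sampleLaw ν φ s μ σ h n)

/-- The minimax risk with sample size `n`; the infimum is over all estimators `est` for which
`est d x` is jointly measurable in the data `d` and the point `x`. -/
def minimaxRisk (ν : Measure X) (φ s : ℝ) (U S H : Set (X → ℝ)) (n : ℕ) : ℝ≥0∞ :=
  ⨅ (est : (Fin n → X × ℝ) → X → ℝ) (_ : Measurable (Function.uncurry est)),
    ⨆ (μ ∈ U) (σ ∈ S) (h ∈ H), risk ν φ s μ σ h n est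

/-- Maximal cardinality of a finite subset of `F` whose distinct elements are at `L₂(h)` distance
greater than `ε`. -/
def packingNumber (ν : Measure X) (h : X → ℝ) (F : Set (X → ℝ)) (ε : ℝ) : ℕ∞ :=
  ⨆ (N : Finset (X → ℝ)) (_ : (N : Set (X → ℝ)) ⊆ F ∧
      (N : Set (X → ℝ)).Pairwise fun f g => ENNReal.ofReal ε < l2Dist ν h f g), (N.card : ℕ∞)

/-- Total boundedness of `F` in the `L₂(h)` distance. -/
def IsTotallyBounded (ν : Measure X) (h : X → ℝ) (F : Set (X → ℝ)) : Prop :=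
  ∀ ε : ℝ, 0 < ε → packingNumber ν h F ε ≠ ⊤

/-- Packing `ε`-entropy in the `L₂(h)` distance (used for totally bounded classes only). -/
def packingEntropy (ν : Measure X) (h : X → ℝ) (F : Set (X → ℝ)) (ε : ℝ) : ℝ :=
  Real.log ((packingNumber ν h F ε).toNat : ℝ)

end Model

/-- Richness of an entropy order; the lower limit is taken in the extended reals. -/
def IsRich (M : ℝ → ℝ) : Prop :=
  ∃ α : ℝ, 0 < α ∧ α < 1 ∧
    1 < liminf (fun ε : ℝ => ((M (α * ε) / M ε : ℝ) : EReal)) (𝓝[>] 0)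

/-- Order regularity of an entropy order. -/
def IsOrderRegular (M : ℝ → ℝ) : Prop :=
  ∀ c : ℝ, 0 < c → M =Θ[𝓝[>] 0] fun ε => M (c * ε)

/-- The point where the nonincreasing function `E` crosses `ε ↦ n ε²`. It is the solution of
`E ε = n ε²` if there is one. -/
def criticalRadius (E : ℝ → ℝ) (n : ℕ) : ℝ :=
  sInf {ε : ℝ | 0 < ε ∧ E ε ≤ n * ε ^ 2}

/-- `R n ≍ r n`. -/
def SameOrder (R : ℕ → ℝ≥0∞) (r : ℕ → ℝ) : Prop :=
  ∃ c C : ℝ, 0 < c ∧ 0 < C ∧ ∀ᶠ n in atTop,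
    ENNReal.ofReal (c * r n) ≤ R n ∧ R n ≤ ENNReal.ofReal (C * r n)

end ExpectileMinimax

end

open ExpectileMinimax

noncomputable section

namespace ExpectileMinimax

/-! The argument rests on the loss `expectileLoss` and on half its derivative, `expectileScore`. The
error density is proportional to `exp (-loss / s ^ 2)`, so density times score is a constant
multiple of the derivative of the density and integrates to zero. Hence 0 is the expectile of the
error. Homogeneity of the score carries this to `μ x`, and strict monotonicity gives uniqueness. The
curvature of the loss lies between `2 * min φ (1 - φ)` and 2, and the centred score satisfies `E exp
(t * score) ≤ exp (K * t ^ 2)` for bounded `t` (`exists_integral_exp_mul_score_le`). Both risk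
bounds follow from these facts.

Upper bound: a maximal `ε`-packing of `U` is also an `ε`-net, and its elements are averaged with
weights exponential in minus the empirical loss (`risk_expAggregate_le`). The aggregate needs
neither `σ` nor `h`. Its risk is of order `(E ε + 1) / n + ε ^ 2`, where `E` is the entropy of `U`.

Lower bound: fix one `σ` and the density `h₀`. Two models whose locations are `ε`-close have a
likelihood ratio with second moment at most `exp (K * n * ε ^ 2)`. Every member of a `δ`-packing is
therefore dominated, up to this factor and an additive 1/4, by a member of an `ε`-net. If the
packing is larger than the net by four times the factor, disjoint events cannot identify all its
members, and the risk is at least `δ ^ 2 / 8` (`exists_le_minimaxRisk`).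

Richness makes `E (k * ε)` exceed any given multiple of `E ε` for a suitable `k`. So when `E ε` has
order `n * ε ^ 2`, the choice `δ = k * ε` matches the upper bound (`sameOrder_of_isTheta`). The
three senses of the rate reduce to this balance. Only the crossing point requires regularity,
because the entropy may jump there. -/

/-! ### The expectile loss and its score -/

/-- The asymmetric squared loss, minimised in mean at the `φ`-th expectile. -/
def expectileLoss (φ u : ℝ) : ℝ := if 0 ≤ u then φ * u ^ 2 else (1 - φ) * u ^ 2

/-- Half the derivative of the asymmetric squared loss. -/
def expectileScore (φ u : ℝ) : ℝ := if 0 ≤ u then φ * u else (1 - φ) * u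

lemma measurable_expectileLoss (φ : ℝ) : Measurable (expectileLoss φ) :=
  Measurable.ite measurableSet_Ici (by fun_prop) (by fun_prop)

lemma measurable_expectileScore (φ : ℝ) : Measurable (expectileScore φ) :=
  Measurable.ite measurableSet_Ici (by fun_prop) (by fun_prop)

lemma expectileScore_mul {φ r : ℝ} (hr : 0 < r) (u : ℝ) :
    expectileScore φ (r * u) = r * expectileScore φ u := by
  unfold expectileScore
  have : 0 ≤ r * u ↔ 0 ≤ u := mul_nonneg_iff_of_pos_left hr
  simp only [this]
  split_ifs <;> ring

lemma abs_expectileScore_le {φ : ℝ} (h0 : 0 < φ) (h1 : φ < 1) (u : ℝ) :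
    |expectileScore φ u| ≤ |u| := by
  unfold expectileScore
  split_ifs
  · rw [abs_mul, abs_of_pos h0]
    exact mul_le_of_le_one_left (abs_nonneg _) h1.le
  · rw [abs_mul, abs_of_pos (sub_pos.2 h1)]
    exact mul_le_of_le_one_left (abs_nonneg _) (by linarith)

lemma min_mul_sq_le_expectileLoss (φ u : ℝ) :
    min φ (1 - φ) * u ^ 2 ≤ expectileLoss φ u := by
  unfold expectileLoss
  split_ifs
  · exact mul_le_mul_of_nonneg_right (min_le_left _ _) (sq_nonneg _)
  · exact mul_le_mul_of_nonneg_right (min_le_right _ _) (sq_nonneg _)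

/-- Strong convexity: the second derivative is `2 * φ` or `2 * (1 - φ)`, hence at least `2 * c`. The
case `c = 0` is plain convexity, which is what the likelihood ratio needs. -/
lemma le_expectileLoss_sub {φ c : ℝ} (hc0 : c ≤ φ) (hc1 : c ≤ 1 - φ) (u a : ℝ) :
    expectileLoss φ u - 2 * a * expectileScore φ u + c * a ^ 2 ≤ expectileLoss φ (u - a) := by
  unfold expectileLoss expectileScore
  have ha := sq_nonneg a
  split_ifs with h1 h2 h2
  · nlinarith
  · have : 0 ≤ u * (a - u) := mul_nonneg h1 (by linarith)
    rcases le_total φ (1 - φ) with h | h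
    · nlinarith [mul_nonneg (sub_nonneg.2 h) (sq_nonneg (u - a))]
    · have : u * (2 * a - u) ≤ a ^ 2 := by nlinarith [sq_nonneg (a - u)]
      nlinarith [mul_nonneg (sub_nonneg.2 h) (mul_nonneg h1 h1),
        mul_nonneg (sub_nonneg.2 h) (mul_nonneg h1 (show 0 ≤ a - u by linarith))]
  · rcases le_total φ (1 - φ) with h | h
    · have h3 : 0 ≤ u * a := by nlinarith
      have h4 : 0 ≤ u * (a - u) := by nlinarith
      nlinarith [mul_nonneg (sub_nonneg.2 h) h3, mul_nonneg (sub_nonneg.2 h) h4]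
    · nlinarith [mul_nonneg (sub_nonneg.2 h) (sq_nonneg (u - a))]
  · nlinarith

lemma expectileLoss_sub_le {φ : ℝ} (h0 : 0 < φ) (h1 : φ < 1) (u a : ℝ) :
    expectileLoss φ (u - a) ≤ expectileLoss φ u - 2 * a * expectileScore φ u + a ^ 2 := by
  unfold expectileLoss expectileScore
  have ha := sq_nonneg a
  have h1' : 0 < 1 - φ := sub_pos.2 h1
  split_ifs with h2 h3 h3
  · nlinarith [mul_nonneg h0.le (sq_nonneg (u - a)), mul_nonneg h1'.le ha]
  · have h4 : u * (u - 2 * a) ≤ 0 := mul_nonpos_of_nonpos_of_nonneg (by linarith) (by linarith)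
    nlinarith [mul_nonneg h1'.le (sq_nonneg (u - a)), mul_nonpos_of_nonneg_of_nonpos h0.le h4]
  · have h4 : u * (u - 2 * a) ≤ 0 := mul_nonpos_of_nonneg_of_nonpos h3 (by linarith)
    nlinarith [mul_nonneg h0.le (sq_nonneg (u - a)), mul_nonpos_of_nonneg_of_nonpos h1'.le h4]
  · nlinarith [mul_nonneg h0.le ha]

lemma expectileScore_sub_le {φ c : ℝ} (hc0 : c ≤ φ) (hc1 : c ≤ 1 - φ) {u v : ℝ} (h : u ≤ v) :
    c * (v - u) ≤ expectileScore φ v - expectileScore φ u := by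
  unfold expectileScore
  split_ifs <;> nlinarith

/-- The lower and upper quadratic bounds trap the first-order remainder between 0 and `a ^ 2`, so
the kink in the score at 0 needs no separate treatment. -/
lemma hasDerivAt_expectileLoss {φ : ℝ} (h0 : 0 < φ) (h1 : φ < 1) (u : ℝ) :
    HasDerivAt (expectileLoss φ) (2 * expectileScore φ u) u := by
  rw [hasDerivAt_iff_isLittleO_nhds_zero]
  refine IsBigO.trans_isLittleO (g := fun a : ℝ => a ^ 2) ?_ ?_
  · refine IsBigO.of_bound 1 (Eventually.of_forall fun a => ?_)
    have hc : 0 ≤ min φ (1 - φ) := le_min h0.le (by linarith)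
    have h3 := le_expectileLoss_sub (min_le_left φ (1 - φ)) (min_le_right φ (1 - φ)) u (-a)
    have h4 := expectileLoss_sub_le h0 h1 u (-a)
    have := mul_nonneg hc (sq_nonneg (-a))
    rw [sub_neg_eq_add] at h3 h4
    rw [Real.norm_eq_abs, Real.norm_of_nonneg (sq_nonneg a), abs_le, smul_eq_mul]
    constructor <;> nlinarith
  · simpa using isLittleO_pow_pow (𝕜 := ℝ) (m := 1) (n := 2) (by norm_num)

/-! ### The error distribution -/

/-- The normalising constant of the asymmetric normal density. -/
def asymNormalConst (φ s : ℝ) : ℝ :=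
  2 / (Real.sqrt Real.pi * s) * (Real.sqrt (φ * (1 - φ)) / (Real.sqrt φ + Real.sqrt (1 - φ)))

lemma asymNormalConst_pos {φ s : ℝ} (h0 : 0 < φ) (h1 : φ < 1) (hs : 0 < s) :
    0 < asymNormalConst φ s := by
  have : 0 < 1 - φ := sub_pos.2 h1
  unfold asymNormalConst
  positivity

lemma asymNormalPDF_zero (φ s y : ℝ) :
    asymNormalPDF φ 0 s y = asymNormalConst φ s * Real.exp (-(expectileLoss φ y / s ^ 2)) := by
  unfold asymNormalPDF asymNormalConst expectileLoss
  congr 3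
  split_ifs <;> ring

lemma measurable_asymNormalPDF (φ s : ℝ) : Measurable (asymNormalPDF φ 0 s) := by
  rw [funext (asymNormalPDF_zero φ s)]
  have := measurable_expectileLoss φ
  fun_prop

lemma asymNormalPDF_nonneg {φ s : ℝ} (h0 : 0 < φ) (h1 : φ < 1) (hs : 0 < s) (y : ℝ) :
    0 ≤ asymNormalPDF φ 0 s y := by
  rw [asymNormalPDF_zero]
  exact mul_nonneg (asymNormalConst_pos h0 h1 hs).le (Real.exp_pos _).le

lemma asymNormalPDF_le {φ s : ℝ} (h0 : 0 < φ) (h1 : φ < 1) (hs : 0 < s) (y : ℝ) :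
    asymNormalPDF φ 0 s y ≤
      asymNormalConst φ s * Real.exp (-(min φ (1 - φ) / s ^ 2) * y ^ 2) := by
  rw [asymNormalPDF_zero]
  refine mul_le_mul_of_nonneg_left (Real.exp_le_exp.2 ?_) (asymNormalConst_pos h0 h1 hs).le
  have := div_le_div_of_nonneg_right (min_mul_sq_le_expectileLoss φ y) (sq_nonneg s)
  calc _ ≤ -(min φ (1 - φ) * y ^ 2 / s ^ 2) := neg_le_neg this
    _ = _ := by ring

lemma integral_errorLaw {φ s : ℝ} (h0 : 0 < φ) (h1 : φ < 1) (hs : 0 < s) (g : ℝ → ℝ) :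
    ∫ y, g y ∂errorLaw φ s = ∫ y, asymNormalPDF φ 0 s y * g y := by
  rw [errorLaw, integral_withDensity_eq_integral_toReal_smul
    (measurable_asymNormalPDF φ s).ennreal_ofReal (by simp)]
  simp [ENNReal.toReal_ofReal (asymNormalPDF_nonneg h0 h1 hs _)]

lemma integrable_errorLaw_iff {φ s : ℝ} (h0 : 0 < φ) (h1 : φ < 1) (hs : 0 < s) (g : ℝ → ℝ) :
    Integrable g (errorLaw φ s) ↔ Integrable fun y => asymNormalPDF φ 0 s y * g y := by
  rw [errorLaw, integrable_withDensity_iff_integrable_smul'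
    (measurable_asymNormalPDF φ s).ennreal_ofReal (by simp)]
  simp [ENNReal.toReal_ofReal (asymNormalPDF_nonneg h0 h1 hs _)]

lemma integrable_exp_abs_errorLaw {φ s : ℝ} (h0 : 0 < φ) (h1 : φ < 1) (hs : 0 < s) (t : ℝ) :
    Integrable (fun y => Real.exp (t * |y|)) (errorLaw φ s) := by
  rw [integrable_errorLaw_iff h0 h1 hs]
  set b := min φ (1 - φ) / s ^ 2 with hb
  have hbpos : 0 < b := div_pos (lt_min h0 (sub_pos.2 h1)) (by positivity)
  have hC := asymNormalConst_pos h0 h1 hs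
  refine Integrable.mono' ((integrable_exp_neg_mul_sq (half_pos hbpos)).const_mul
    (asymNormalConst φ s * Real.exp (t ^ 2 / (2 * b)))) ?_ (Eventually.of_forall fun y => ?_)
  · have := measurable_asymNormalPDF φ s
    exact Measurable.aestronglyMeasurable (by fun_prop)
  · rw [Real.norm_of_nonneg (mul_nonneg (asymNormalPDF_nonneg h0 h1 hs y) (Real.exp_pos _).le)]
    calc _ ≤ asymNormalConst φ s * Real.exp (-b * y ^ 2) * Real.exp (t * |y|) :=
          mul_le_mul_of_nonneg_right (asymNormalPDF_le h0 h1 hs y) (Real.exp_pos _).le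
      _ ≤ _ := by
        rw [mul_assoc, mul_assoc, ← Real.exp_add, ← Real.exp_add]
        refine mul_le_mul_of_nonneg_left (Real.exp_le_exp.2 ?_) hC.le
        -- Completing the square gives `t * |y| ≤ b / 2 * y ^ 2 + t ^ 2 / (2 * b)`, so half of the
        -- Gaussian exponent is left for integrability.
        have h : 0 ≤ (b * |y| - t) ^ 2 / (2 * b) := by positivity
        have h' : (b * |y| - t) ^ 2 / (2 * b) = b / 2 * y ^ 2 - t * |y| + t ^ 2 / (2 * b) := by
          rw [← sq_abs y]; field_simp; ring
        linarith

lemma integral_exp_expectileLoss {φ s : ℝ} (h0 : 0 < φ) (h1 : φ < 1) (hs : 0 < s) :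
    ∫ y, Real.exp (-(expectileLoss φ y / s ^ 2)) =
      Real.sqrt (Real.pi / (φ / s ^ 2)) / 2 + Real.sqrt (Real.pi / ((1 - φ) / s ^ 2)) / 2 := by
  have h1' : 0 < 1 - φ := sub_pos.2 h1
  have e1 : ∀ y ∈ Set.Ioi (0 : ℝ), Real.exp (-(expectileLoss φ y / s ^ 2)) =
      Real.exp (-(φ / s ^ 2) * y ^ 2) := fun y hy => by
    rw [expectileLoss, if_pos (le_of_lt hy)]; congr 1; ring
  have e2 : ∀ y ∈ Set.Ioi (0 : ℝ), Real.exp (-(expectileLoss φ (-y) / s ^ 2)) =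
      Real.exp (-((1 - φ) / s ^ 2) * y ^ 2) := fun y hy => by
    rw [expectileLoss, if_neg (not_le.2 (neg_lt_zero.2 hy))]; congr 1; ring
  have hint : Integrable fun y => Real.exp (-(expectileLoss φ y / s ^ 2)) := by
    have h := integrable_exp_abs_errorLaw h0 h1 hs 0
    rw [integrable_errorLaw_iff h0 h1 hs] at h
    simp only [zero_mul, Real.exp_zero, mul_one, asymNormalPDF_zero] at h
    have := h.const_mul (asymNormalConst φ s)⁻¹
    simpa [← mul_assoc, inv_mul_cancel₀ (asymNormalConst_pos h0 h1 hs).ne'] using this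
  rw [← integral_add_compl measurableSet_Ioi hint (s := Set.Ioi (0 : ℝ)), Set.compl_Ioi,
    setIntegral_congr_fun measurableSet_Ioi e1, integral_gaussian_Ioi]
  congr 1
  have := integral_comp_neg_Ioi (0 : ℝ) fun y => Real.exp (-(expectileLoss φ y / s ^ 2))
  rw [neg_zero] at this
  rw [← this, setIntegral_congr_fun measurableSet_Ioi e2, integral_gaussian_Ioi]

lemma isProbabilityMeasure_errorLaw {φ s : ℝ} (h0 : 0 < φ) (h1 : φ < 1) (hs : 0 < s) :
    IsProbabilityMeasure (errorLaw φ s) := by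
  have h1' : 0 < 1 - φ := sub_pos.2 h1
  have hint : Integrable (asymNormalPDF φ 0 s) := by
    simpa [integrable_errorLaw_iff h0 h1 hs] using integrable_exp_abs_errorLaw h0 h1 hs 0
  refine ⟨?_⟩
  rw [errorLaw, withDensity_apply _ MeasurableSet.univ, Measure.restrict_univ,
    ← ofReal_integral_eq_lintegral_ofReal hint
      (Eventually.of_forall (asymNormalPDF_nonneg h0 h1 hs))]
  simp_rw [asymNormalPDF_zero]
  rw [integral_const_mul, integral_exp_expectileLoss h0 h1 hs, asymNormalConst,
    ← ENNReal.ofReal_one]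
  congr 1
  rw [div_div_eq_mul_div, div_div_eq_mul_div, Real.sqrt_div (by positivity),
    Real.sqrt_div (by positivity), Real.sqrt_mul Real.pi_pos.le, Real.sqrt_sq hs.le,
    Real.sqrt_mul h0.le]
  have a1 : 0 < √φ := Real.sqrt_pos.2 h0
  have a2 : 0 < √(1 - φ) := Real.sqrt_pos.2 h1'
  have a3 : 0 < √Real.pi := Real.sqrt_pos.2 Real.pi_pos
  field_simp
  ring

lemma integrable_errorLaw_of_abs_le_exp {φ s : ℝ} (h0 : 0 < φ) (h1 : φ < 1) (hs : 0 < s)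
    {g : ℝ → ℝ} (hg : Measurable g) (t : ℝ) (h : ∀ y, |g y| ≤ Real.exp (t * |y|)) :
    Integrable g (errorLaw φ s) :=
  (integrable_exp_abs_errorLaw h0 h1 hs t).mono' hg.aestronglyMeasurable (Eventually.of_forall h)

lemma abs_le_exp_abs (y : ℝ) : |y| ≤ Real.exp |y| :=
  (le_add_of_nonneg_right zero_le_one).trans (Real.add_one_le_exp _)

lemma integrable_id_errorLaw {φ s : ℝ} (h0 : 0 < φ) (h1 : φ < 1) (hs : 0 < s) :
    Integrable (fun y => y) (errorLaw φ s) :=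
  integrable_errorLaw_of_abs_le_exp h0 h1 hs measurable_id 1 fun y => by
    simpa using abs_le_exp_abs y

lemma integrable_expectileScore {φ s : ℝ} (h0 : 0 < φ) (h1 : φ < 1) (hs : 0 < s) :
    Integrable (expectileScore φ) (errorLaw φ s) :=
  (integrable_id_errorLaw h0 h1 hs).mono (measurable_expectileScore φ).aestronglyMeasurable
    (Eventually.of_forall fun y => abs_expectileScore_le h0 h1 y)

/-- The derivative of the density is `-(2 / s ^ 2)` times density times score, and the density
vanishes at both ends of the line. -/
lemma integral_expectileScore {φ s : ℝ} (h0 : 0 < φ) (h1 : φ < 1) (hs : 0 < s) :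
    ∫ y, expectileScore φ y ∂errorLaw φ s = 0 := by
  have hb : 0 < min φ (1 - φ) / s ^ 2 := div_pos (lt_min h0 (sub_pos.2 h1)) (by positivity)
  have hC := asymNormalConst_pos h0 h1 hs
  have hint := (integrable_errorLaw_iff h0 h1 hs _).1 (integrable_expectileScore h0 h1 hs)
  have hder : ∀ y, HasDerivAt (asymNormalPDF φ 0 s)
      (-(2 / s ^ 2) * (asymNormalPDF φ 0 s y * expectileScore φ y)) y := fun y => by
    rw [funext (asymNormalPDF_zero φ s)]
    refine ((((hasDerivAt_expectileLoss h0 h1 y).div_const (s ^ 2)).neg.exp).const_mul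
      (asymNormalConst φ s)).congr_deriv ?_
    simp only [Pi.neg_apply]
    ring
  have hlim : ∀ l : Filter ℝ, Tendsto (fun y : ℝ => y ^ 2) l atTop →
      Tendsto (asymNormalPDF φ 0 s) l (𝓝 0) := fun l hl => by
    refine squeeze_zero (asymNormalPDF_nonneg h0 h1 hs) (asymNormalPDF_le h0 h1 hs) ?_
    rw [← mul_zero (asymNormalConst φ s)]
    refine Tendsto.const_mul _ (Real.tendsto_exp_atBot.comp ?_)
    exact (tendsto_const_mul_atBot_of_neg (neg_lt_zero.2 hb)).2 hl
  have h := integral_of_hasDerivAt_of_tendsto hder (hint.const_mul _)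
    (hlim atBot ?_) (hlim atTop (tendsto_pow_atTop two_ne_zero))
  · rw [integral_const_mul, sub_zero] at h
    rw [integral_errorLaw h0 h1 hs]
    rcases mul_eq_zero.1 h with h | h
    · exact absurd h (by simp [hs.ne'])
    · exact h
  · refine ((tendsto_pow_atTop (α := ℝ) two_ne_zero).comp tendsto_abs_atBot_atTop).congr ?_
    exact sq_abs

lemma exp_le_one_add_add_sq_mul_exp_abs (x : ℝ) :
    Real.exp x ≤ 1 + x + x ^ 2 * Real.exp |x| := by
  have h := Complex.norm_exp_sub_sum_le_norm_mul_exp (x : ℂ) 2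
  simp only [Finset.sum_range_succ, Finset.sum_range_zero] at h
  have h2 : Complex.exp x - (0 + (x : ℂ) ^ 0 / ((0 : ℕ).factorial : ℂ) +
      (x : ℂ) ^ 1 / ((1 : ℕ).factorial : ℂ)) = ((Real.exp x - (1 + x) : ℝ) : ℂ) := by
    push_cast; simp
  rw [h2, Complex.norm_real, Complex.norm_real, Real.norm_eq_abs, Real.norm_eq_abs, sq_abs] at h
  linarith [le_abs_self (Real.exp x - (1 + x))]

/-- In the second-order expansion of the exponential the linear term integrates to zero, and the
remainder is at most `t ^ 2` times a moment that is finite because the error has all exponential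
moments. -/
lemma exists_integral_exp_mul_score_le {φ s : ℝ} (h0 : 0 < φ) (h1 : φ < 1) (hs : 0 < s)
    {T : ℝ} (hT : 0 ≤ T) :
    ∃ K, 0 < K ∧ ∀ t, |t| ≤ T →
      ∫⁻ y, ENNReal.ofReal (Real.exp (t * expectileScore φ y)) ∂errorLaw φ s ≤
        ENNReal.ofReal (Real.exp (K * t ^ 2)) := by
  have := isProbabilityMeasure_errorLaw h0 h1 hs
  have hm := measurable_expectileScore φ
  have hbound : ∀ y, |expectileScore φ y ^ 2 * Real.exp (T * |expectileScore φ y|)| ≤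
      Real.exp ((2 + T) * |y|) := fun y => by
    have h := abs_expectileScore_le h0 h1 y
    rw [abs_mul, Real.abs_exp, abs_pow]
    calc _ ≤ Real.exp |y| ^ 2 * Real.exp (T * |y|) := by
          gcongr
          exact h.trans (abs_le_exp_abs y)
      _ = _ := by rw [← Real.exp_nat_mul, ← Real.exp_add]; congr 1; push_cast; ring
  have hI2 := integrable_errorLaw_of_abs_le_exp h0 h1 hs (by fun_prop) (2 + T) hbound
  have hI1 := integrable_expectileScore h0 h1 hs
  set K₀ := ∫ y, expectileScore φ y ^ 2 * Real.exp (T * |expectileScore φ y|) ∂errorLaw φ s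
  have hK₀ : 0 ≤ K₀ := integral_nonneg fun y => by positivity
  refine ⟨K₀ + 1, by linarith, fun t ht => ?_⟩
  have hle : ∀ y, Real.exp (t * expectileScore φ y) ≤ 1 + t * expectileScore φ y +
      t ^ 2 * (expectileScore φ y ^ 2 * Real.exp (T * |expectileScore φ y|)) := fun y => by
    refine (exp_le_one_add_add_sq_mul_exp_abs _).trans ?_
    rw [mul_pow, mul_assoc, abs_mul]
    gcongr
  have hI3 : Integrable (fun y => 1 + t * expectileScore φ y) (errorLaw φ s) :=
    (integrable_const 1).add (hI1.const_mul t)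
  have hI4 : Integrable (fun y => 1 + t * expectileScore φ y +
      t ^ 2 * (expectileScore φ y ^ 2 * Real.exp (T * |expectileScore φ y|))) (errorLaw φ s) :=
    hI3.add (hI2.const_mul (t ^ 2))
  refine (lintegral_mono fun y => ENNReal.ofReal_le_ofReal (hle y)).trans ?_
  rw [← ofReal_integral_eq_lintegral_ofReal hI4
    (Eventually.of_forall fun y => (Real.exp_pos _).le.trans (hle y))]
  refine ENNReal.ofReal_le_ofReal ?_
  rw [integral_add hI3 (hI2.const_mul _), integral_add (integrable_const _) (hI1.const_mul _),
    integral_const_mul, integral_const_mul, integral_expectileScore h0 h1 hs]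
  simp only [integral_const, probReal_univ, smul_eq_mul, mul_zero, mul_one, add_zero]
  have := Real.add_one_le_exp ((K₀ + 1) * t ^ 2)
  nlinarith [sq_nonneg t]

/-! ### The location is the conditional expectile -/

lemma isExpectile_iff_integral_score {φ : ℝ} {Q : Measure ℝ} [IsFiniteMeasure Q] (z : ℝ) :
    IsExpectile φ Q z ↔
      Integrable (fun y : ℝ => y) Q ∧ ∫ y, expectileScore φ (y - z) ∂Q = 0 := by
  refine and_congr_right fun hQ => ?_
  have hint : Integrable (fun y => z - y) Q := (integrable_const z).sub hQ
  rw [← integral_indicator measurableSet_Iic, ← integral_const_mul, ← sub_eq_zero,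
    ← integral_sub (hint.indicator measurableSet_Iic) (hint.abs.const_mul φ), ← neg_eq_zero,
    ← integral_neg]
  refine Eq.congr (integral_congr_ae (Eventually.of_forall fun y => ?_)) rfl
  simp only [Set.indicator, Set.mem_Iic, expectileScore, sub_nonneg]
  rcases lt_trichotomy y z with h | h | h
  · rw [if_pos h.le, if_neg (not_le.2 h), abs_of_pos (sub_pos.2 h)]; ring
  · simp [h]
  · rw [if_neg (not_le.2 h), if_pos h.le, abs_of_neg (sub_neg.2 h)]; ring

/-- As a function of `w`, the mean of `expectileScore φ (y - w)` decreases with slope at least `min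
φ (1 - φ)` in absolute value, so it has at most one zero. The zero is at `μ x`, since the positive
scale factors out of the score. -/
lemma isExpectile_responseLaw_iff {X : Type*} {φ s : ℝ} (h0 : 0 < φ) (h1 : φ < 1) (hs : 0 < s)
    {μ σ : X → ℝ} {x : X} (hσ : 0 < σ x) (z : ℝ) :
    IsExpectile φ (responseLaw φ s μ σ x) z ↔ z = μ x := by
  have := isProbabilityMeasure_errorLaw h0 h1 hs
  have hmeas : Measurable fun e : ℝ => μ x + σ x * e := by fun_prop
  have hprob : IsProbabilityMeasure (responseLaw φ s μ σ x) :=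
    Measure.isProbabilityMeasure_map hmeas.aemeasurable
  have hint : Integrable (fun y : ℝ => y) (responseLaw φ s μ σ x) := by
    rw [responseLaw, integrable_map_measure (by fun_prop) hmeas.aemeasurable]
    exact (integrable_const _).add ((integrable_id_errorLaw h0 h1 hs).const_mul _)
  have hsm := measurable_expectileScore φ
  have hscore : ∀ w, Integrable (fun y => expectileScore φ (y - w)) (responseLaw φ s μ σ x) :=
    fun w => (hint.sub (integrable_const w)).mono
      (hsm.comp (measurable_sub_const w)).aestronglyMeasurable
      (Eventually.of_forall fun y => abs_expectileScore_le h0 h1 _)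
  have hzero : ∫ y, expectileScore φ (y - μ x) ∂responseLaw φ s μ σ x = 0 := by
    rw [responseLaw, integral_map hmeas.aemeasurable
      (hscore (μ x)).aestronglyMeasurable]
    simp_rw [add_sub_cancel_left, expectileScore_mul hσ]
    rw [integral_const_mul, integral_expectileScore h0 h1 hs, mul_zero]
  have hc : 0 < min φ (1 - φ) := lt_min h0 (sub_pos.2 h1)
  have hmono : ∀ w v, w ≤ v → min φ (1 - φ) * (v - w) ≤
      ∫ y, expectileScore φ (y - w) ∂responseLaw φ s μ σ x -
        ∫ y, expectileScore φ (y - v) ∂responseLaw φ s μ σ x := fun w v hwv => by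
    rw [← integral_sub (hscore w) (hscore v)]
    have : min φ (1 - φ) * (v - w) =
        ∫ _, min φ (1 - φ) * (v - w) ∂responseLaw φ s μ σ x := by simp
    rw [this]
    refine integral_mono (integrable_const _) ((hscore w).sub (hscore v)) fun y => ?_
    have := expectileScore_sub_le (min_le_left φ (1 - φ)) (min_le_right φ (1 - φ))
      (show y - v ≤ y - w by linarith)
    calc _ = min φ (1 - φ) * (y - w - (y - v)) := by ring
      _ ≤ _ := this
  rw [isExpectile_iff_integral_score]
  refine ⟨fun h => ?_, fun h => ⟨hint, h ▸ hzero⟩⟩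
  rcases le_total z (μ x) with hz | hz
  · have := hmono z (μ x) hz
    rw [h.2, hzero, sub_zero] at this
    nlinarith
  · have := hmono (μ x) z hz
    rw [h.2, hzero, sub_zero] at this
    nlinarith

section Packing

variable {X : Type*} [MeasurableSpace X] {ν : Measure X} {h : X → ℝ} {F : Set (X → ℝ)}

/-! ### Packings -/

lemma l2Dist_self (f : X → ℝ) : l2Dist ν h f f = 0 := by simp [l2Dist]

lemma l2Dist_comm (f g : X → ℝ) : l2Dist ν h f g = l2Dist ν h g f := by
  rw [l2Dist, l2Dist, ← eLpNorm_neg]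
  congr 1
  ext x
  simp

lemma l2Dist_triangle {f g k : X → ℝ} (hf : Measurable f) (hg : Measurable g)
    (hk : Measurable k) : l2Dist ν h f k ≤ l2Dist ν h f g + l2Dist ν h g k := by
  have : (fun x => f x - k x) = (fun x => f x - g x) + fun x => g x - k x := by
    ext x; simp
  rw [l2Dist, this]
  exact eLpNorm_add_le (hf.sub hg).aestronglyMeasurable (hg.sub hk).aestronglyMeasurable one_le_two

/-- A packing of maximal cardinality is also a net. -/
lemma exists_maximal_packing (hF : IsTotallyBounded ν h F) {ε : ℝ} (hε : 0 < ε) :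
    ∃ N : Finset (X → ℝ), (N : Set (X → ℝ)) ⊆ F ∧
      ((N : Set (X → ℝ)).Pairwise fun f g => ENNReal.ofReal ε < l2Dist ν h f g) ∧
      N.card = (packingNumber ν h F ε).toNat ∧
      ∀ f ∈ F, ∃ g ∈ N, l2Dist ν h f g ≤ ENNReal.ofReal ε := by
  classical
  have htop := hF ε hε
  have hle : ∀ N : Finset (X → ℝ), (N : Set (X → ℝ)) ⊆ F →
      ((N : Set (X → ℝ)).Pairwise fun f g => ENNReal.ofReal ε < l2Dist ν h f g) →
      (N.card : ℕ∞) ≤ packingNumber ν h F ε := fun N h1 h2 =>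
    le_iSup₂_of_le (f := fun (N : Finset (X → ℝ)) (_ : (N : Set (X → ℝ)) ⊆ F ∧
      (N : Set (X → ℝ)).Pairwise fun f g => ENNReal.ofReal ε < l2Dist ν h f g) =>
        (N.card : ℕ∞)) N ⟨h1, h2⟩ le_rfl
  have hex : ∃ N : Finset (X → ℝ), ((N : Set (X → ℝ)) ⊆ F ∧
      (N : Set (X → ℝ)).Pairwise fun f g => ENNReal.ofReal ε < l2Dist ν h f g) ∧
      (N.card : ℕ∞) = packingNumber ν h F ε := by
    rw [packingNumber, iSup_subtype'] at htop ⊢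
    have : Nonempty {N : Finset (X → ℝ) // (N : Set (X → ℝ)) ⊆ F ∧
      (N : Set (X → ℝ)).Pairwise fun f g => ENNReal.ofReal ε < l2Dist ν h f g} :=
      ⟨⟨∅, by simp⟩⟩
    obtain ⟨N, hN⟩ := ENat.exists_eq_iSup_of_lt_top (lt_top_iff_ne_top.2 htop)
    exact ⟨N.1, N.2, hN⟩
  obtain ⟨N, ⟨hNF, hNp⟩, hN⟩ := hex
  refine ⟨N, hNF, hNp, by rw [← hN]; simp, fun f hf => ?_⟩
  by_contra! hcon
  have hfN : f ∉ N := fun hfN => by simpa [l2Dist_self] using hcon f hfN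
  have h1 := hle (insert f N) (by simpa [Set.insert_subset_iff] using ⟨hf, hNF⟩) (by
    rw [Finset.coe_insert]
    refine hNp.insert fun g hg _ => ⟨hcon g hg, ?_⟩
    rw [l2Dist_comm]
    exact hcon g hg)
  rw [← hN, Finset.card_insert_of_notMem hfN] at h1
  exact absurd (Nat.cast_le.1 h1) (by simp)

lemma packingNumber_antitone : Antitone (packingNumber ν h F) := fun _ _ hab =>
  iSup_mono fun _ => iSup_mono' fun hN =>
    ⟨⟨hN.1, hN.2.mono' fun _ _ h => (ENNReal.ofReal_le_ofReal hab).trans_lt h⟩, le_rfl⟩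

lemma packingEntropy_le_of_le (hF : IsTotallyBounded ν h F) {ε δ : ℝ} (hε : 0 < ε)
    (hεδ : ε ≤ δ) : packingEntropy ν h F δ ≤ packingEntropy ν h F ε := by
  have h1 := ENat.toNat_le_toNat (packingNumber_antitone (ν := ν) (h := h) (F := F) hεδ) (hF ε hε)
  unfold packingEntropy
  -- A vanishing packing number has logarithm 0 by convention, which causes no harm since entropies
  -- are nonnegative.
  rcases Nat.eq_zero_or_pos (packingNumber ν h F δ).toNat with h0 | h0
  · rw [h0]
    simpa using Real.log_natCast_nonneg _
  · exact Real.log_le_log (by exact_mod_cast h0) (by exact_mod_cast h1)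

end Packing

section Model

variable {X : Type*} [MeasurableSpace X] {ν : Measure X} {h : X → ℝ}

/-! ### The sampling distributions -/

lemma IsDensity.isProbabilityMeasure (hh : IsDensity ν h) :
    IsProbabilityMeasure (designLaw ν h) :=
  ⟨by rw [designLaw, withDensity_apply _ MeasurableSet.univ, Measure.restrict_univ,
    hh.lintegral_eq_one]⟩

lemma l2Dist_sq (f g : X → ℝ) :
    l2Dist ν h f g ^ 2 = ∫⁻ x, ENNReal.ofReal ((g x - f x) ^ 2) ∂designLaw ν h := by
  have h := eLpNorm_nnreal_pow_eq_lintegral (f := fun x => f x - g x) (μ := designLaw ν h)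
    (p := 2) (by norm_num)
  rw [l2Dist]
  simp only [ENNReal.coe_ofNat, NNReal.coe_ofNat, ENNReal.rpow_ofNat] at h
  rw [h]
  refine lintegral_congr fun x => ?_
  rw [← ofReal_norm, ← ENNReal.ofReal_pow (norm_nonneg _), Real.norm_eq_abs, sq_abs]
  congr 1
  ring

lemma integrable_sq_sub [IsFiniteMeasure (designLaw ν h)] {f g : X → ℝ} (hf : Measurable f)
    (hg : Measurable g) {J : ℝ} (hfJ : ∀ x, |f x| ≤ J) (hgJ : ∀ x, |g x| ≤ J) :
    Integrable (fun x => (g x - f x) ^ 2) (designLaw ν h) := by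
  refine Integrable.of_bound ((hg.sub hf).pow_const 2).aestronglyMeasurable ((2 * J) ^ 2)
    (Eventually.of_forall fun x => ?_)
  rw [norm_pow]
  have : |g x - f x| ≤ 2 * J := (abs_sub _ _).trans (by linarith [hfJ x, hgJ x])
  exact pow_le_pow_left₀ (norm_nonneg _) this 2

lemma l2Dist_sq_eq_ofReal [IsFiniteMeasure (designLaw ν h)] {f g : X → ℝ} (hf : Measurable f)
    (hg : Measurable g) {J : ℝ} (hfJ : ∀ x, |f x| ≤ J) (hgJ : ∀ x, |g x| ≤ J) :
    l2Dist ν h f g ^ 2 = ENNReal.ofReal (∫ x, (g x - f x) ^ 2 ∂designLaw ν h) := by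
  rw [l2Dist_sq, ofReal_integral_eq_lintegral_ofReal (integrable_sq_sub hf hg hfJ hgJ)
    (Eventually.of_forall fun x => sq_nonneg _)]

lemma designLaw_le {h₀ : X → ℝ} (h₀m : Measurable h₀) {C : ℝ} (hC : 0 ≤ C)
    (hle : ∀ᵐ x ∂ν, h x ≤ C * h₀ x) : designLaw ν h ≤ ENNReal.ofReal C • designLaw ν h₀ := by
  rw [designLaw, designLaw, ← withDensity_smul _ h₀m.ennreal_ofReal]
  refine withDensity_mono ?_
  filter_upwards [hle] with x hx
  rw [Pi.smul_apply, smul_eq_mul, ← ENNReal.ofReal_mul hC]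
  exact ENNReal.ofReal_le_ofReal hx

lemma l2Dist_sq_le_of_le {h₀ : X → ℝ} (h₀m : Measurable h₀) {C : ℝ} (hC : 0 ≤ C)
    (hle : ∀ᵐ x ∂ν, h x ≤ C * h₀ x) (f g : X → ℝ) :
    l2Dist ν h f g ^ 2 ≤ ENNReal.ofReal C * l2Dist ν h₀ f g ^ 2 := by
  rw [l2Dist_sq, l2Dist_sq, ← smul_eq_mul, ← lintegral_smul_measure]
  exact lintegral_mono' (designLaw_le h₀m hC hle) le_rfl

variable {φ s : ℝ} {μ σ : X → ℝ}

lemma measurable_observe (hμ : Measurable μ) (hσ : Measurable σ) :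
    Measurable fun p : X × ℝ => (p.1, μ p.1 + σ p.1 * p.2) := by fun_prop

lemma lintegral_observationLaw [SFinite (designLaw ν h)] [SFinite (errorLaw φ s)]
    (hμ : Measurable μ) (hσ : Measurable σ)
    {F : X × ℝ → ℝ≥0∞} (hF : Measurable F) :
    ∫⁻ p, F p ∂observationLaw ν φ s μ σ h =
      ∫⁻ x, ∫⁻ e, F (x, μ x + σ x * e) ∂errorLaw φ s ∂designLaw ν h := by
  rw [observationLaw, lintegral_map hF (measurable_observe hμ hσ), lintegral_prod]
  exact (hF.comp (measurable_observe hμ hσ)).aemeasurable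

lemma isProbabilityMeasure_observationLaw [IsProbabilityMeasure (designLaw ν h)]
    [IsProbabilityMeasure (errorLaw φ s)] (hμ : Measurable μ) (hσ : Measurable σ) :
    IsProbabilityMeasure (observationLaw ν φ s μ σ h) :=
  Measure.isProbabilityMeasure_map (measurable_observe hμ hσ).aemeasurable

lemma lintegral_pi_prod {Ω : Type*} [MeasurableSpace Ω] (P : Measure Ω) [IsProbabilityMeasure P]
    (n : ℕ) {F : Fin n → Ω → ℝ≥0∞} (hF : ∀ i, Measurable (F i)) :
    ∫⁻ d, ∏ i, F i (d i) ∂Measure.pi (fun _ : Fin n => P) = ∏ i, ∫⁻ p, F i p ∂P := by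
  rw [ProbabilityTheory.lintegral_prod_eq_prod_lintegral_of_indepFun Finset.univ
    (fun i (d : Fin n → Ω) => F i (d i))
    (ProbabilityTheory.iIndepFun_pi (μ := fun _ : Fin n => P) (X := F) fun i => (hF i).aemeasurable)
    (fun i => (hF i).comp (measurable_pi_apply i))]
  refine Finset.prod_congr rfl fun i _ => ?_
  exact (measurePreserving_eval (fun _ : Fin n => P) i).lintegral_comp (hF i)

lemma pi_withDensity {Ω : Type*} [MeasurableSpace Ω] (P : Measure Ω) [IsProbabilityMeasure P]
    (n : ℕ) {L : Ω → ℝ≥0∞} (hL : Measurable L) [IsProbabilityMeasure (P.withDensity L)] :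
    Measure.pi (fun _ : Fin n => P.withDensity L) =
      (Measure.pi fun _ : Fin n => P).withDensity fun d => ∏ i, L (d i) := by
  refine Measure.pi_eq fun A hA => ?_
  rw [withDensity_apply _ (MeasurableSet.univ_pi hA),
    ← lintegral_indicator (MeasurableSet.univ_pi hA)]
  have : ∀ d : Fin n → Ω, (Set.univ.pi A).indicator (fun d => ∏ i, L (d i)) d =
      ∏ i, (A i).indicator L (d i) := fun d => by
    by_cases hd : d ∈ Set.univ.pi A
    · rw [Set.indicator_of_mem hd]
      exact Finset.prod_congr rfl fun i _ => (Set.indicator_of_mem (hd i trivial) L).symm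
    · rw [Set.indicator_of_notMem hd]
      simp only [Set.mem_pi, Set.mem_univ, true_imp_iff, not_forall] at hd
      obtain ⟨i, hi⟩ := hd
      exact (Finset.prod_eq_zero (Finset.mem_univ i) (Set.indicator_of_notMem hi L)).symm
  simp_rw [this]
  rw [lintegral_pi_prod P n fun i => hL.indicator (hA i)]
  refine Finset.prod_congr rfl fun i _ => ?_
  rw [lintegral_indicator (hA i), withDensity_apply _ (hA i)]

end Model

/-! ### Exponentially weighted aggregation -/

/-- The exponent lies in `[-1, 1]`, where `exp w ≤ 1 + w + w ^ 2`. The square costs at most half of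
the negative drift and doubles the positive term. A bound affine in the squares is needed because it
is later integrated over the covariate. -/
lemma exp_le_of_sub_bound {c lam J a b v : ℝ} (hc0 : 0 < c) (hc1 : c ≤ 1) (hlam : 0 < lam)
    (hJ : 8 * J ^ 2 * lam ≤ 1) (ha : b ^ 2 ≤ (2 * J) ^ 2) (hb : a ^ 2 ≤ (2 * J) ^ 2)
    (hv : v ≤ lam * (2 * b ^ 2 - c / 2 * a ^ 2)) :
    Real.exp v ≤ 1 + lam * (4 * b ^ 2 - c / 4 * a ^ 2) := by
  set w := lam * (2 * b ^ 2 - c / 2 * a ^ 2) with hw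
  set p := lam * b ^ 2 with hp
  set q := lam * a ^ 2 with hq
  have hp0 : 0 ≤ p := by positivity
  have hq0 : 0 ≤ q := by positivity
  have hp1 : p ≤ 1 / 2 := by nlinarith
  have hq1 : q ≤ 1 / 2 := by nlinarith
  have hwpq : w = 2 * p - c / 2 * q := by rw [hw, hp, hq]; ring
  have hcq : c * q ≤ q := mul_le_of_le_one_left hq0 hc1
  have hcq0 : 0 ≤ c * q := mul_nonneg hc0.le hq0
  have habs : |w| ≤ 1 := by
    rw [hwpq, abs_le]
    constructor <;> linarith
  have h1 := (abs_le.1 (Real.abs_exp_sub_one_sub_id_le habs)).2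
  have h2 : w ^ 2 ≤ 2 * p + c / 4 * q := by
    rw [hwpq]
    nlinarith [mul_nonneg hp0 hcq0, mul_nonneg hcq0 (show 0 ≤ 1 - c * q by linarith),
      mul_nonneg hp0 (show 0 ≤ 1 / 2 - p by linarith)]
  calc Real.exp v ≤ Real.exp w := Real.exp_le_exp.2 hv
    _ ≤ 1 + w + w ^ 2 := by linarith
    _ ≤ 1 + (4 * p - c / 4 * q) := by rw [hwpq] at h2 ⊢; linarith
    _ = _ := by rw [hp, hq]; ring

section Weights

variable {X : Type*} {φ : ℝ}

/-- The empirical expectile loss of `g`. -/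
def empiricalLoss (φ : ℝ) {n : ℕ} (g : X → ℝ) (d : Fin n → X × ℝ) : ℝ :=
  ∑ i, expectileLoss φ ((d i).2 - g (d i).1)

/-- The exponential weight of `g` among the elements of `G`. -/
def expWeight (φ lam : ℝ) {n : ℕ} (G : Finset (X → ℝ)) (g : X → ℝ) (d : Fin n → X × ℝ) : ℝ :=
  Real.exp (-lam * empiricalLoss φ g d) / ∑ f ∈ G, Real.exp (-lam * empiricalLoss φ f d)

/-- The exponentially weighted aggregate of the elements of `G`. -/
def expAggregate (φ lam : ℝ) (n : ℕ) (G : Finset (X → ℝ)) (d : Fin n → X × ℝ) (x : X) : ℝ :=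
  ∑ g ∈ G, expWeight φ lam G g d * g x

lemma sum_exp_empiricalLoss_pos {lam : ℝ} {n : ℕ} {G : Finset (X → ℝ)} (hG : G.Nonempty)
    (d : Fin n → X × ℝ) : 0 < ∑ f ∈ G, Real.exp (-lam * empiricalLoss φ f d) :=
  Finset.sum_pos (fun _ _ => Real.exp_pos _) hG

lemma expWeight_nonneg {lam : ℝ} {n : ℕ} {G : Finset (X → ℝ)} (g : X → ℝ)
    (d : Fin n → X × ℝ) : 0 ≤ expWeight φ lam G g d :=
  div_nonneg (Real.exp_pos _).le (Finset.sum_nonneg fun _ _ => (Real.exp_pos _).le)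

lemma sum_expWeight {lam : ℝ} {n : ℕ} {G : Finset (X → ℝ)} (hG : G.Nonempty)
    (d : Fin n → X × ℝ) : ∑ g ∈ G, expWeight φ lam G g d = 1 := by
  unfold expWeight
  rw [← Finset.sum_div, div_self (sum_exp_empiricalLoss_pos hG d).ne']

lemma expWeight_le {lam : ℝ} {n : ℕ} {G : Finset (X → ℝ)} {f : X → ℝ} (hf : f ∈ G) (g : X → ℝ)
    (d : Fin n → X × ℝ) : expWeight φ lam G g d ≤
      Real.exp (lam * (empiricalLoss φ f d - empiricalLoss φ g d)) := by
  have h : Real.exp (-lam * empiricalLoss φ f d) ≤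
      ∑ f ∈ G, Real.exp (-lam * empiricalLoss φ f d) :=
    Finset.single_le_sum (f := fun f => Real.exp (-lam * empiricalLoss φ f d))
      (fun _ _ => (Real.exp_pos _).le) hf
  calc _ ≤ Real.exp (-lam * empiricalLoss φ g d) / Real.exp (-lam * empiricalLoss φ f d) :=
        div_le_div_of_nonneg_left (Real.exp_pos _).le (Real.exp_pos _) h
    _ = _ := by rw [← Real.exp_sub]; congr 1; ring

end Weights

/-! ### Risk of the exponentially weighted aggregate -/

section Risk

variable {X : Type*} [MeasurableSpace X] {ν : Measure X} {h : X → ℝ} {φ s : ℝ} {μ σ : X → ℝ}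

/-- Given the covariate, the curvature bounds turn the loss difference into a multiple of the score
plus the drift `a₀ ^ 2 - c * a ^ 2`. The moment bound for the score costs a term quadratic in `lam`,
and the drift, linear in `lam`, absorbs it when `lam` is small. -/
lemma lintegral_exp_expectileLoss_sub_le (h0 : 0 < φ) (h1 : φ < 1) (hs : 0 < s)
    (hh : IsDensity ν h) {J b K lam : ℝ} (hlam0 : 0 < lam) (hlam1 : lam ≤ 1)
    (hlamJ : 8 * J ^ 2 * lam ≤ 1) (hlamK : 16 * K * b ^ 2 * lam ≤ min φ (1 - φ)) (hK0 : 0 < K)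
    (hK : ∀ t, |t| ≤ 8 * b * J →
      ∫⁻ y, ENNReal.ofReal (Real.exp (t * expectileScore φ y)) ∂errorLaw φ s ≤
        ENNReal.ofReal (Real.exp (K * t ^ 2)))
    (hμ : Measurable μ) (hμJ : ∀ x, |μ x| ≤ J) (hσ : Measurable σ)
    (hσb : ∀ x, 0 < σ x ∧ σ x ≤ b) {f g : X → ℝ}
    (hf : Measurable f) (hfJ : ∀ x, |f x| ≤ J) (hg : Measurable g) (hgJ : ∀ x, |g x| ≤ J) :
    ∫⁻ p, ENNReal.ofReal (Real.exp (lam * (expectileLoss φ (p.2 - f p.1) -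
        expectileLoss φ (p.2 - g p.1)))) ∂observationLaw ν φ s μ σ h ≤
      ENNReal.ofReal (Real.exp (lam * (4 * ∫ x, (f x - μ x) ^ 2 ∂designLaw ν h -
        min φ (1 - φ) / 4 * ∫ x, (g x - μ x) ^ 2 ∂designLaw ν h))) := by
  have := isProbabilityMeasure_errorLaw h0 h1 hs
  have := hh.isProbabilityMeasure
  have hlm := measurable_expectileLoss φ
  set c := min φ (1 - φ) with hc
  have hc0 : 0 < c := lt_min h0 (sub_pos.2 h1)
  have hc1 : c ≤ 1 := (min_le_left _ _).trans h1.le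
  have hbd : ∀ {f : X → ℝ}, (∀ x, |f x| ≤ J) → ∀ x, |f x - μ x| ≤ 2 * J := fun hf x =>
    (abs_sub _ _).trans (by linarith [hf x, hμJ x])
  have hIf := integrable_sq_sub (ν := ν) (h := h) hμ hf hμJ hfJ
  have hIg := integrable_sq_sub (ν := ν) (h := h) hμ hg hμJ hgJ
  have hI : Integrable (fun x => lam * (4 * (f x - μ x) ^ 2 - c / 4 * (g x - μ x) ^ 2))
      (designLaw ν h) := ((hIf.const_mul 4).sub (hIg.const_mul (c / 4))).const_mul lam
  have key : ∀ x, ∫⁻ e, ENNReal.ofReal (Real.exp (lam * (expectileLoss φ (μ x + σ x * e - f x) -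
        expectileLoss φ (μ x + σ x * e - g x)))) ∂errorLaw φ s ≤
      ENNReal.ofReal (1 + lam * (4 * (f x - μ x) ^ 2 - c / 4 * (g x - μ x) ^ 2)) ∧
      0 ≤ 1 + lam * (4 * (f x - μ x) ^ 2 - c / 4 * (g x - μ x) ^ 2) := fun x => by
    obtain ⟨hσ0, hσ1⟩ := hσb x
    have hb0 : 0 < b := hσ0.trans_le hσ1
    set a₀ := f x - μ x with ha₀
    set a := g x - μ x with ha
    have h₀ : |a₀| ≤ 2 * J := hbd hfJ x
    have h : |a| ≤ 2 * J := hbd hgJ x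
    set t := 2 * lam * σ x * (a - a₀) with ht
    have habs : |a - a₀| ≤ 4 * J := (abs_sub _ _).trans (by linarith)
    have htT : |t| ≤ 8 * b * J := by
      rw [ht, abs_mul, abs_of_pos (by positivity)]
      calc 2 * lam * σ x * |a - a₀| ≤ 2 * 1 * b * (4 * J) := by gcongr
        _ = _ := by ring
    have hexp : Real.exp (K * t ^ 2 + lam * (a₀ ^ 2 - c * a ^ 2)) ≤
        1 + lam * (4 * a₀ ^ 2 - c / 4 * a ^ 2) := by
      refine exp_le_of_sub_bound (J := J) hc0 hc1 hlam0 hlamJ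
        (sq_le_sq' (abs_le.1 h₀).1 (abs_le.1 h₀).2) (sq_le_sq' (abs_le.1 h).1 (abs_le.1 h).2) ?_
      -- The condition on `lam` and `K` enters here: fluctuations use up at most half of the drift
      -- `-c * a ^ 2`.
      have h3 : K * t ^ 2 ≤ lam * (c / 2 * (a ^ 2 + a₀ ^ 2)) := by
        have : K * t ^ 2 ≤ lam * ((16 * K * b ^ 2 * lam) / 4 * (a - a₀) ^ 2) := by
          rw [ht]
          calc _ = 4 * K * lam ^ 2 * (a - a₀) ^ 2 * σ x ^ 2 := by ring
            _ ≤ 4 * K * lam ^ 2 * (a - a₀) ^ 2 * b ^ 2 := by gcongr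
            _ = _ := by ring
        refine this.trans (mul_le_mul_of_nonneg_left ?_ hlam0.le)
        calc _ ≤ c / 4 * (a - a₀) ^ 2 := by gcongr
          _ ≤ c / 4 * (2 * (a ^ 2 + a₀ ^ 2)) := by
            gcongr
            nlinarith [sq_nonneg (a + a₀)]
          _ = _ := by ring
      have h4 : lam * (c * a₀ ^ 2) ≤ lam * (1 * a₀ ^ 2) := by gcongr
      nlinarith
    refine ⟨?_, (Real.exp_pos _).le.trans hexp⟩
    calc _ ≤ ∫⁻ e, ENNReal.ofReal (Real.exp (t * expectileScore φ e)) *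
          ENNReal.ofReal (Real.exp (lam * (a₀ ^ 2 - c * a ^ 2))) ∂errorLaw φ s := by
          refine lintegral_mono fun e => ?_
          rw [← ENNReal.ofReal_mul (Real.exp_pos _).le, ← Real.exp_add]
          refine ENNReal.ofReal_le_ofReal (Real.exp_le_exp.2 ?_)
          have e1 := expectileLoss_sub_le h0 h1 (σ x * e) a₀
          have e2 := le_expectileLoss_sub (min_le_left φ (1 - φ)) (min_le_right φ (1 - φ))
            (σ x * e) a
          rw [expectileScore_mul hσ0] at e1 e2
          have e3 : μ x + σ x * e - f x = σ x * e - a₀ := by rw [ha₀]; ring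
          have e4 : μ x + σ x * e - g x = σ x * e - a := by rw [ha]; ring
          rw [e3, e4]
          calc _ ≤ lam * (2 * (a - a₀) * (σ x * expectileScore φ e) + (a₀ ^ 2 - c * a ^ 2)) :=
                mul_le_mul_of_nonneg_left (by linarith) hlam0.le
            _ = _ := by rw [ht]; ring
      _ ≤ ENNReal.ofReal (Real.exp (K * t ^ 2)) *
          ENNReal.ofReal (Real.exp (lam * (a₀ ^ 2 - c * a ^ 2))) := by
          have := measurable_expectileScore φ
          rw [lintegral_mul_const _ (by fun_prop)]
          exact mul_le_mul_left (hK t htT) _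
      _ ≤ _ := by
          rw [← ENNReal.ofReal_mul (Real.exp_pos _).le, ← Real.exp_add]
          exact ENNReal.ofReal_le_ofReal hexp
  rw [lintegral_observationLaw hμ hσ (by fun_prop)]
  refine (lintegral_mono fun x => (key x).1).trans ?_
  have hI1 : Integrable (fun x => 1 + lam * (4 * (f x - μ x) ^ 2 - c / 4 * (g x - μ x) ^ 2))
      (designLaw ν h) := (integrable_const 1).add hI
  rw [← ofReal_integral_eq_lintegral_ofReal hI1
    (Eventually.of_forall fun x => (key x).2)]
  refine ENNReal.ofReal_le_ofReal ?_
  rw [integral_add (integrable_const 1) hI, integral_const_mul,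
    integral_sub (hIf.const_mul 4) (hIg.const_mul _), integral_const_mul, integral_const_mul]
  simp only [integral_const, probReal_univ, smul_eq_mul, mul_one]
  linarith [Real.add_one_le_exp (lam * (4 * ∫ x, (f x - μ x) ^ 2 ∂designLaw ν h -
    c / 4 * ∫ x, (g x - μ x) ^ 2 ∂designLaw ν h))]

lemma measurable_empiricalLoss {n : ℕ} {g : X → ℝ} (hg : Measurable g) :
    Measurable (empiricalLoss φ g : (Fin n → X × ℝ) → ℝ) := by
  have := measurable_expectileLoss φ
  unfold empiricalLoss
  fun_prop

lemma measurable_expWeight {lam : ℝ} {n : ℕ} {G : Finset (X → ℝ)} (hG : ∀ g ∈ G, Measurable g)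
    {g : X → ℝ} (hg : g ∈ G) :
    Measurable (expWeight φ lam G g : (Fin n → X × ℝ) → ℝ) := by
  unfold expWeight
  refine Measurable.div ?_ (Finset.measurable_fun_sum _ fun f hf => ?_)
  · exact ((measurable_empiricalLoss (hG g hg)).const_mul _).exp
  · exact ((measurable_empiricalLoss (hG f hf)).const_mul _).exp

lemma measurable_expAggregate {lam : ℝ} {n : ℕ} {G : Finset (X → ℝ)}
    (hG : ∀ g ∈ G, Measurable g) : Measurable (Function.uncurry (expAggregate φ lam n G)) := by
  unfold expAggregate Function.uncurry
  refine Finset.measurable_fun_sum _ fun g hg => ?_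
  exact ((measurable_expWeight hG hg).comp measurable_fst).mul ((hG g hg).comp measurable_snd)

/-- Jensen's inequality for the square: the weights are nonnegative and sum to 1. -/
lemma l2Dist_expAggregate_sq_le [IsFiniteMeasure (designLaw ν h)] {lam J : ℝ} {n : ℕ}
    {G : Finset (X → ℝ)} (hG : G.Nonempty) (hGm : ∀ g ∈ G, Measurable g)
    (hGJ : ∀ g ∈ G, ∀ x, |g x| ≤ J) (hμ : Measurable μ) (hμJ : ∀ x, |μ x| ≤ J)
    (d : Fin n → X × ℝ) :
    l2Dist ν h μ (expAggregate φ lam n G d) ^ 2 ≤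
      ENNReal.ofReal (∑ g ∈ G, expWeight φ lam G g d * ∫ x, (g x - μ x) ^ 2 ∂designLaw ν h) := by
  have hI : ∀ g ∈ G, Integrable (fun x => expWeight φ lam G g d * (g x - μ x) ^ 2)
      (designLaw ν h) := fun g hg =>
    (integrable_sq_sub hμ (hGm g hg) hμJ (hGJ g hg)).const_mul _
  simp_rw [← integral_const_mul]
  rw [← integral_finsetSum _ hI, ofReal_integral_eq_lintegral_ofReal (integrable_finsetSum _ hI)
    (Eventually.of_forall fun x => Finset.sum_nonneg fun g _ =>
      mul_nonneg (expWeight_nonneg g d) (sq_nonneg _)), l2Dist_sq]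
  refine lintegral_mono fun x => ENNReal.ofReal_le_ofReal ?_
  have hsum := sum_expWeight (φ := φ) (lam := lam) hG d
  have e : expAggregate φ lam n G d x - μ x =
      ∑ g ∈ G, expWeight φ lam G g d • (g x - μ x) := by
    simp only [smul_eq_mul, mul_sub, Finset.sum_sub_distrib, ← Finset.sum_mul, hsum, one_mul]
    rfl
  rw [e]
  exact (Even.convexOn_pow even_two).map_sum_le (fun g _ => expWeight_nonneg g d) hsum
    (fun _ _ => Set.mem_univ _)

/-- Multiplying `k * D g ≤ L + exp (k * D g - L)` by the weights bounds the averaged loss by `L`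
plus exponential terms. In those terms each weight is replaced by a ratio to the weight of the
comparison element `f`, and the ratio factors over the observations. -/
lemma risk_expAggregate_le (h0 : 0 < φ) (h1 : φ < 1) (hs : 0 < s)
    (hh : IsDensity ν h) {J b K lam : ℝ} (hlam0 : 0 < lam) (hlam1 : lam ≤ 1)
    (hlamJ : 8 * J ^ 2 * lam ≤ 1) (hlamK : 16 * K * b ^ 2 * lam ≤ min φ (1 - φ)) (hK0 : 0 < K)
    (hK : ∀ t, |t| ≤ 8 * b * J →
      ∫⁻ y, ENNReal.ofReal (Real.exp (t * expectileScore φ y)) ∂errorLaw φ s ≤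
        ENNReal.ofReal (Real.exp (K * t ^ 2)))
    (hμ : Measurable μ) (hμJ : ∀ x, |μ x| ≤ J) (hσ : Measurable σ)
    (hσb : ∀ x, 0 < σ x ∧ σ x ≤ b) {G : Finset (X → ℝ)} (hGm : ∀ g ∈ G, Measurable g)
    (hGJ : ∀ g ∈ G, ∀ x, |g x| ≤ J) {f : X → ℝ} (hf : f ∈ G) {n : ℕ} (hn : 0 < n) :
    risk ν φ s μ σ h n (expAggregate φ lam n G) ≤
      ENNReal.ofReal ((Real.log G.card + 4 * n * lam * ∫ x, (f x - μ x) ^ 2 ∂designLaw ν h + 1) /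
        (n * (lam * min φ (1 - φ) / 4))) := by
  have := isProbabilityMeasure_errorLaw h0 h1 hs
  have := hh.isProbabilityMeasure
  have := isProbabilityMeasure_observationLaw (ν := ν) (h := h) (φ := φ) (s := s) hμ hσ
  have hlm := measurable_expectileLoss φ
  have hprob : IsProbabilityMeasure (sampleLaw ν φ s μ σ h n) := by
    unfold sampleLaw; infer_instance
  have hGne : G.Nonempty := ⟨f, hf⟩
  set c := min φ (1 - φ) with hc
  have hc0 : 0 < c := lt_min h0 (sub_pos.2 h1)
  set D : (X → ℝ) → ℝ := fun g => ∫ x, (g x - μ x) ^ 2 ∂designLaw ν h with hD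
  have hD0 : ∀ g, 0 ≤ D g := fun g => integral_nonneg fun x => sq_nonneg _
  have hn' : (0 : ℝ) < n := by exact_mod_cast hn
  set k := n * (lam * c / 4) with hk
  have hk0 : 0 < k := by positivity
  have hcard : (0 : ℝ) < G.card := by exact_mod_cast hGne.card_pos
  have hcard1 : (1 : ℝ) ≤ G.card := by exact_mod_cast hGne.card_pos
  -- With this `L` each exponential term has expectation at most `1 / G.card`, so together they
  -- contribute at most 1.
  set L := Real.log G.card + 4 * n * lam * D f with hL
  have hL0 : 0 ≤ L := add_nonneg (Real.log_nonneg hcard1) (by have := hD0 f; positivity)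
  have hpt : ∀ d : Fin n → X × ℝ, k * ∑ g ∈ G, expWeight φ lam G g d * D g ≤
      L + ∑ g ∈ G, Real.exp (k * D g - L) *
        Real.exp (lam * (empiricalLoss φ f d - empiricalLoss φ g d)) := fun d => by
    have hsum := sum_expWeight (φ := φ) (lam := lam) hGne d
    calc k * ∑ g ∈ G, expWeight φ lam G g d * D g
        = ∑ g ∈ G, expWeight φ lam G g d * (k * D g) := by
          rw [Finset.mul_sum]; exact Finset.sum_congr rfl fun _ _ => by ring
      _ ≤ ∑ g ∈ G, expWeight φ lam G g d * (L + Real.exp (k * D g - L)) := by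
          refine Finset.sum_le_sum fun g _ =>
            mul_le_mul_of_nonneg_left ?_ (expWeight_nonneg g d)
          linarith [Real.add_one_le_exp (k * D g - L)]
      _ = L + ∑ g ∈ G, Real.exp (k * D g - L) * expWeight φ lam G g d := by
          simp only [mul_add, Finset.sum_add_distrib, ← Finset.sum_mul, hsum, one_mul]
          congr 1
          exact Finset.sum_congr rfl fun _ _ => mul_comm _ _
      _ ≤ _ := by
          gcongr with g hg
          exact expWeight_le hf g d
  have hone : ∀ g ∈ G, ∫⁻ d, ENNReal.ofReal (Real.exp (k * D g - L) *
      Real.exp (lam * (empiricalLoss φ f d - empiricalLoss φ g d))) ∂sampleLaw ν φ s μ σ h n ≤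
      ENNReal.ofReal ((G.card : ℝ)⁻¹) := fun g hg => by
    have hfac : ∀ d : Fin n → X × ℝ, ENNReal.ofReal (Real.exp (k * D g - L) *
        Real.exp (lam * (empiricalLoss φ f d - empiricalLoss φ g d))) =
        ENNReal.ofReal (Real.exp (k * D g - L)) * ∏ i, ENNReal.ofReal (Real.exp (lam *
          (expectileLoss φ ((d i).2 - f (d i).1) - expectileLoss φ ((d i).2 - g (d i).1)))) :=
      fun d => by
        rw [ENNReal.ofReal_mul (Real.exp_pos _).le,
          ← ENNReal.ofReal_prod_of_nonneg fun _ _ => (Real.exp_pos _).le, ← Real.exp_sum,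
          ← Finset.mul_sum, Finset.sum_sub_distrib]
        rfl
    have hfm := hGm f hf
    have hgm := hGm g hg
    simp_rw [hfac]
    rw [lintegral_const_mul _ (by fun_prop), sampleLaw,
      lintegral_pi_prod _ n (F := fun _ (p : X × ℝ) => ENNReal.ofReal (Real.exp (lam *
        (expectileLoss φ (p.2 - f p.1) - expectileLoss φ (p.2 - g p.1)))))
        (fun _ => by fun_prop)]
    rw [Finset.prod_const, Finset.card_univ, Fintype.card_fin]
    refine (mul_le_mul_right (pow_le_pow_left' (lintegral_exp_expectileLoss_sub_le h0 h1 hs hh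
      hlam0 hlam1 hlamJ hlamK hK0 hK hμ hμJ hσ hσb hfm (hGJ f hf) hgm (hGJ g hg)) n) _).trans ?_
    rw [← ENNReal.ofReal_pow (Real.exp_pos _).le, ← ENNReal.ofReal_mul (Real.exp_pos _).le,
      ← Real.exp_nat_mul, ← Real.exp_add]
    refine ENNReal.ofReal_le_ofReal (le_of_eq ?_)
    have : k * D g - L + n * (lam * (4 * D f - c / 4 * D g)) = -Real.log G.card := by
      rw [hk, hL]; ring
    rw [this, Real.exp_neg, Real.exp_log hcard]
  have hmain : ENNReal.ofReal k * risk ν φ s μ σ h n (expAggregate φ lam n G) ≤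
      ENNReal.ofReal (L + 1) := by
    unfold risk
    rw [← lintegral_const_mul' _ _ ENNReal.ofReal_ne_top]
    calc _ ≤ ∫⁻ d, (ENNReal.ofReal L + ∑ g ∈ G, ENNReal.ofReal (Real.exp (k * D g - L) *
          Real.exp (lam * (empiricalLoss φ f d - empiricalLoss φ g d))))
            ∂sampleLaw ν φ s μ σ h n := by
          refine lintegral_mono fun d => ?_
          refine (mul_le_mul_right (l2Dist_expAggregate_sq_le hGne hGm hGJ hμ hμJ d) _).trans ?_
          rw [← ENNReal.ofReal_mul hk0.le, ← ENNReal.ofReal_sum_of_nonneg fun _ _ => by positivity,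
            ← ENNReal.ofReal_add hL0 (Finset.sum_nonneg fun _ _ => by positivity)]
          exact ENNReal.ofReal_le_ofReal (hpt d)
      _ = ENNReal.ofReal L + ∑ g ∈ G, ∫⁻ d, ENNReal.ofReal (Real.exp (k * D g - L) *
          Real.exp (lam * (empiricalLoss φ f d - empiricalLoss φ g d)))
            ∂sampleLaw ν φ s μ σ h n := by
          rw [lintegral_add_left measurable_const, lintegral_const, measure_univ, mul_one,
            lintegral_finsetSum]
          intro g hg
          have h1 : Measurable (empiricalLoss φ f : (Fin n → X × ℝ) → ℝ) :=
            measurable_empiricalLoss (hGm f hf)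
          have h2 : Measurable (empiricalLoss φ g : (Fin n → X × ℝ) → ℝ) :=
            measurable_empiricalLoss (hGm g hg)
          fun_prop
      _ ≤ ENNReal.ofReal L + ∑ g ∈ G, ENNReal.ofReal ((G.card : ℝ)⁻¹) := by
          gcongr with g hg
          exact hone g hg
      _ = _ := by
          rw [← ENNReal.ofReal_sum_of_nonneg fun _ _ => by positivity, Finset.sum_const,
            nsmul_eq_mul, mul_inv_cancel₀ hcard.ne', ENNReal.ofReal_add hL0 zero_le_one]
  rw [ENNReal.ofReal_div_of_pos hk0]
  rw [ENNReal.le_div_iff_mul_le (Or.inl (by simpa using hk0)) (Or.inl ENNReal.ofReal_ne_top),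
    mul_comm]
  exact hmain

/-- The minimax risk is at most of order `E ε / n + ε²` for every radius `ε`. -/
lemma exists_minimaxRisk_le (h0 : 0 < φ) (h1 : φ < 1) (hs : 0 < s)
    {U : Set (X → ℝ)} (hUmeas : ∀ μ ∈ U, Measurable μ)
    (hUbdd : ∃ J : ℝ, ∀ μ ∈ U, ∀ x, |μ x| ≤ J)
    {S : Set (X → ℝ)} (hSmeas : ∀ σ ∈ S, Measurable σ)
    (hSbdd : ∃ b : ℝ, 1 < b ∧ ∀ σ ∈ S, ∀ x, b⁻¹ ≤ σ x ∧ σ x ≤ b)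
    {H : Set (X → ℝ)} (hH : ∀ h ∈ H, IsDensity ν h)
    {h₀ : X → ℝ} (hh₀ : h₀ ∈ H) (hdom : ∃ C : ℝ, ∀ h ∈ H, ∀ᵐ x ∂ν, h x ≤ C * h₀ x)
    (hUtb : IsTotallyBounded ν h₀ U) :
    ∃ K : ℝ, 0 < K ∧ ∀ (ε : ℝ) (n : ℕ), 0 < ε → 0 < n →
      minimaxRisk ν φ s U S H n ≤
        ENNReal.ofReal (K * ((packingEntropy ν h₀ U ε + 1) / n + ε ^ 2)) := by
  obtain ⟨J', hJ'⟩ := hUbdd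
  obtain ⟨b, hb, hSb⟩ := hSbdd
  obtain ⟨C', hC'⟩ := hdom
  -- `J ≥ 1` makes the constraint `8 * J ^ 2 * lam ≤ 1` imply `lam ≤ 1`.
  set J := max J' 1
  have hJ1 : 1 ≤ J := le_max_right _ _
  have hJ : ∀ μ ∈ U, ∀ x, |μ x| ≤ J := fun μ hμ x => (hJ' μ hμ x).trans (le_max_left _ _)
  set C := max C' 0
  have hC0 : 0 ≤ C := le_max_right _ _
  have hC : ∀ h ∈ H, ∀ᵐ x ∂ν, h x ≤ C * h₀ x := fun h hh => by
    filter_upwards [hC' h hh] with x hx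
    exact hx.trans (mul_le_mul_of_nonneg_right (le_max_left _ _) ((hH h₀ hh₀).nonneg x))
  have hc0 : 0 < min φ (1 - φ) := lt_min h0 (sub_pos.2 h1)
  obtain ⟨K, hK0, hK⟩ := exists_integral_exp_mul_score_le h0 h1 hs (T := 8 * b * J)
    (by positivity)
  obtain ⟨lam, hlam0, hlam1, hlamJ, hlamK⟩ : ∃ lam : ℝ, 0 < lam ∧ lam ≤ 1 ∧
      8 * J ^ 2 * lam ≤ 1 ∧ 16 * K * b ^ 2 * lam ≤ min φ (1 - φ) := by
    have hb0 : 0 < b := by linarith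
    refine ⟨min (1 / (8 * J ^ 2)) (min φ (1 - φ) / (16 * K * b ^ 2)), by positivity, ?_, ?_, ?_⟩
    · refine (min_le_left _ _).trans ((div_le_one (by positivity)).2 ?_)
      nlinarith
    · calc _ ≤ 8 * J ^ 2 * (1 / (8 * J ^ 2)) := by gcongr; exact min_le_left _ _
        _ = 1 := by field_simp
    · calc _ ≤ 16 * K * b ^ 2 * (min φ (1 - φ) / (16 * K * b ^ 2)) := by
            gcongr; exact min_le_right _ _
        _ = _ := by field_simp
  set k := lam * min φ (1 - φ) / 4 with hk
  have hk0 : 0 < k := by positivity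
  refine ⟨k⁻¹ * (1 + 4 * lam * C), by positivity, fun ε n hε hn => ?_⟩
  obtain ⟨G, hGU, -, hGcard, hGnet⟩ := exists_maximal_packing hUtb hε
  have hn' : (0 : ℝ) < n := by exact_mod_cast hn
  refine (iInf₂_le (expAggregate φ lam n G)
    (measurable_expAggregate fun g hg => hUmeas g (hGU hg))).trans ?_
  refine iSup₂_le fun μ hμ => iSup₂_le fun σ hσ => iSup₂_le fun h hh => ?_
  obtain ⟨g, hg, hgε⟩ := hGnet μ hμ
  have := (hH h hh).isProbabilityMeasure
  refine (risk_expAggregate_le h0 h1 hs (hH h hh) hlam0 hlam1 hlamJ hlamK hK0 hK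
    (hUmeas μ hμ) (hJ μ hμ) (hSmeas σ hσ)
    (fun x => ⟨(by positivity : 0 < b⁻¹).trans_le (hSb σ hσ x).1, (hSb σ hσ x).2⟩)
    (fun g hg => hUmeas g (hGU hg)) (fun g hg => hJ g (hGU hg)) hg hn).trans
      (ENNReal.ofReal_le_ofReal ?_)
  -- The net is built in `L₂(h₀)`; domination of `h` by `C * h₀` transfers its accuracy to `L₂(h)`.
  have hD : ∫ x, (g x - μ x) ^ 2 ∂designLaw ν h ≤ C * ε ^ 2 := by
    have h2 := l2Dist_sq_le_of_le (hH h₀ hh₀).measurable hC0 (hC h hh) μ g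
    rw [l2Dist_sq_eq_ofReal (hUmeas μ hμ) (hUmeas g (hGU hg)) (hJ μ hμ) (hJ g (hGU hg))] at h2
    have h3 := h2.trans (mul_le_mul_right (pow_le_pow_left' hgε 2) _)
    rw [← ENNReal.ofReal_pow hε.le, ← ENNReal.ofReal_mul hC0] at h3
    exact (ENNReal.ofReal_le_ofReal_iff (by positivity)).1 h3
  have hlog : Real.log G.card = packingEntropy ν h₀ U ε := by rw [packingEntropy, hGcard]
  have hE : 0 ≤ packingEntropy ν h₀ U ε := Real.log_natCast_nonneg _
  rw [← hlog] at hE ⊢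
  calc _ ≤ (Real.log G.card + 4 * n * lam * (C * ε ^ 2) + 1) / (n * k) := by
        gcongr
    _ = k⁻¹ * ((Real.log G.card + 1) / n + 4 * lam * C * ε ^ 2) := by field_simp; ring
    _ ≤ k⁻¹ * ((1 + 4 * lam * C) * ((Real.log G.card + 1) / n) +
        (1 + 4 * lam * C) * ε ^ 2) := by
        have h3 : 0 ≤ 4 * lam * C := by positivity
        gcongr
        · exact le_mul_of_one_le_left (by positivity) (by linarith)
        · linarith
    _ = _ := by ring

end Risk

section LowerBound

variable {X : Type*} {φ s : ℝ} {μ μ' σ : X → ℝ}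

/-! ### Likelihood ratios and the lower bound -/

/-- Likelihood ratio of the model with location `μ'` to that with location `μ`, when both have
scale `σ`. -/
def likelihoodRatio (φ s : ℝ) (μ μ' σ : X → ℝ) (p : X × ℝ) : ℝ :=
  Real.exp (-((expectileLoss φ ((p.2 - μ' p.1) / σ p.1) -
    expectileLoss φ ((p.2 - μ p.1) / σ p.1)) / s ^ 2))

lemma likelihoodRatio_apply {x : X} (hσ : 0 < σ x) (e : ℝ) :
    likelihoodRatio φ s μ μ' σ (x, μ x + σ x * e) =
      Real.exp (-((expectileLoss φ (e - (μ' x - μ x) / σ x) - expectileLoss φ e) / s ^ 2)) := by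
  have e1 : (μ x + σ x * e - μ' x) / σ x = e - (μ' x - μ x) / σ x := by field_simp; ring
  have e2 : (μ x + σ x * e - μ x) / σ x = e := by field_simp; ring
  simp only [likelihoodRatio, e1, e2]

variable [MeasurableSpace X] {ν : Measure X} {h : X → ℝ}

lemma measurable_likelihoodRatio (hμ : Measurable μ) (hμ' : Measurable μ') (hσ : Measurable σ) :
    Measurable (likelihoodRatio φ s μ μ' σ) := by
  have := measurable_expectileLoss φ
  unfold likelihoodRatio
  fun_prop

/-- On each fibre, changing the location translates the error by `(μ' x - μ x) / σ x`, and Lebesgue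
measure is translation invariant. -/
lemma observationLaw_eq_withDensity (h0 : 0 < φ) (h1 : φ < 1) (hs : 0 < s)
    (hh : IsDensity ν h) (hμ : Measurable μ) (hμ' : Measurable μ') (hσ : Measurable σ)
    (hσ0 : ∀ x, 0 < σ x) :
    observationLaw ν φ s μ' σ h = (observationLaw ν φ s μ σ h).withDensity
      fun p => ENNReal.ofReal (likelihoodRatio φ s μ μ' σ p) := by
  have := isProbabilityMeasure_errorLaw h0 h1 hs
  have := hh.isProbabilityMeasure
  have hLm := (measurable_likelihoodRatio (φ := φ) (s := s) hμ hμ' hσ).ennreal_ofReal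
  have hpm := (measurable_asymNormalPDF φ s).ennreal_ofReal
  ext A hA
  have hAm : Measurable (A.indicator (1 : X × ℝ → ℝ≥0∞)) := measurable_one.indicator hA
  rw [withDensity_apply _ hA, ← lintegral_indicator hA, ← lintegral_indicator_one hA,
    lintegral_observationLaw hμ' hσ hAm, lintegral_observationLaw hμ hσ (hLm.indicator hA)]
  refine lintegral_congr fun x => ?_
  set a := (μ' x - μ x) / σ x with ha
  have hAx : Measurable fun e : ℝ => A.indicator (1 : X × ℝ → ℝ≥0∞) (x, μ' x + σ x * e) :=
    hAm.comp (by fun_prop)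
  have hLx : Measurable fun e : ℝ => A.indicator
      (fun p => ENNReal.ofReal (likelihoodRatio φ s μ μ' σ p)) (x, μ x + σ x * e) :=
    (hLm.indicator hA).comp (by fun_prop)
  rw [errorLaw, lintegral_withDensity_eq_lintegral_mul _ hpm hAx,
    lintegral_withDensity_eq_lintegral_mul _ hpm hLx,
    ← lintegral_sub_right_eq_self _ a]
  refine lintegral_congr fun e => ?_
  have hpt : μ' x + σ x * (e - a) = μ x + σ x * e := by
    have := (hσ0 x).ne'
    rw [ha]; field_simp; ring
  simp only [Pi.mul_apply, hpt]
  by_cases hmem : (x, μ x + σ x * e) ∈ A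
  · rw [Set.indicator_of_mem hmem, Set.indicator_of_mem hmem, Pi.one_apply, mul_one,
      likelihoodRatio_apply (hσ0 x), ← ENNReal.ofReal_mul (asymNormalPDF_nonneg h0 h1 hs e),
      asymNormalPDF_zero, asymNormalPDF_zero, mul_assoc, ← Real.exp_add]
    congr 3
    ring
  · rw [Set.indicator_of_notMem hmem, Set.indicator_of_notMem hmem, mul_zero, mul_zero]

/-- Convexity bounds the squared ratio by the exponential of a multiple of the score, whose moment
bound is quadratic in the shift. Since the locations are bounded, this exponential is at most an
affine function of the squared difference, which can be integrated over the covariate. -/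
lemma exists_lintegral_likelihoodRatio_sq_le (h0 : 0 < φ) (h1 : φ < 1) (hs : 0 < s)
    (hh : IsDensity ν h) {J b : ℝ} (hJ0 : 0 ≤ J) (hb0 : 0 < b) (hσ : Measurable σ)
    (hσb : ∀ x, b⁻¹ ≤ σ x) :
    ∃ K : ℝ, 0 < K ∧ ∀ μ μ' : X → ℝ, Measurable μ → Measurable μ' → (∀ x, |μ x| ≤ J) →
      (∀ x, |μ' x| ≤ J) →
      ∫⁻ p, ENNReal.ofReal (likelihoodRatio φ s μ μ' σ p ^ 2) ∂observationLaw ν φ s μ σ h ≤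
        ENNReal.ofReal (Real.exp (K * ∫ x, (μ' x - μ x) ^ 2 ∂designLaw ν h)) := by
  have := isProbabilityMeasure_errorLaw h0 h1 hs
  have := hh.isProbabilityMeasure
  obtain ⟨K, hK0, hK⟩ := exists_integral_exp_mul_score_le h0 h1 hs (T := 8 * J * b / s ^ 2)
    (by positivity)
  set B := K * (16 * b ^ 2 / s ^ 4) with hB
  have hB0 : 0 < B := by positivity
  refine ⟨B * Real.exp (B * (2 * J) ^ 2), by positivity, fun μ μ' hμ hμ' hμJ hμ'J => ?_⟩
  have hI := integrable_sq_sub (ν := ν) (h := h) hμ hμ' hμJ hμ'J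
  have hLm := measurable_likelihoodRatio (φ := φ) (s := s) hμ hμ' hσ
  rw [lintegral_observationLaw hμ hσ (by fun_prop)]
  have key : ∀ x, ∫⁻ e, ENNReal.ofReal (likelihoodRatio φ s μ μ' σ (x, μ x + σ x * e) ^ 2)
      ∂errorLaw φ s ≤
      ENNReal.ofReal (1 + B * Real.exp (B * (2 * J) ^ 2) * (μ' x - μ x) ^ 2) := fun x => by
    have hσ0 : 0 < σ x := (inv_pos.2 hb0).trans_le (hσb x)
    set m := μ' x - μ x with hm
    have hmJ : |m| ≤ 2 * J := (abs_sub _ _).trans (by linarith [hμJ x, hμ'J x])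
    have hmJ2 : m ^ 2 ≤ (2 * J) ^ 2 := sq_le_sq' (abs_le.1 hmJ).1 (abs_le.1 hmJ).2
    set a := m / σ x with ha
    have hσinv : (σ x)⁻¹ ≤ b := inv_le_of_inv_le₀ hb0 (hσb x)
    have habs : |a| ≤ b * |m| := by
      rw [ha, abs_div, abs_of_pos hσ0, div_eq_inv_mul]
      gcongr
    set t := 4 * a / s ^ 2 with ht
    have htT : |t| ≤ 8 * J * b / s ^ 2 := by
      rw [ht, abs_div, abs_mul, abs_of_pos (by positivity : (0 : ℝ) < s ^ 2),
        abs_of_pos (by norm_num : (0 : ℝ) < 4)]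
      calc _ ≤ 4 * (b * (2 * J)) / s ^ 2 := by gcongr; exact habs.trans (by gcongr)
        _ = _ := by ring
    calc _ ≤ ∫⁻ e, ENNReal.ofReal (Real.exp (t * expectileScore φ e)) ∂errorLaw φ s := by
          refine lintegral_mono fun e => ENNReal.ofReal_le_ofReal ?_
          rw [likelihoodRatio_apply hσ0, ← Real.exp_nat_mul]
          refine Real.exp_le_exp.2 ?_
          have h3 := le_expectileLoss_sub h0.le (sub_pos.2 h1).le e a
          calc _ = 2 * (expectileLoss φ e - expectileLoss φ (e - a)) / s ^ 2 := by
                push_cast; ring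
            _ ≤ 2 * (2 * a * expectileScore φ e) / s ^ 2 := by gcongr; linarith
            _ = _ := by rw [ht]; ring
      _ ≤ ENNReal.ofReal (Real.exp (K * t ^ 2)) := hK t htT
      _ ≤ _ := by
          refine ENNReal.ofReal_le_ofReal ?_
          have h4 : K * t ^ 2 ≤ B * m ^ 2 := by
            have : a ^ 2 ≤ (b * |m|) ^ 2 := sq_le_sq' (abs_le.1 habs).1 (abs_le.1 habs).2
            calc K * t ^ 2 = K * (16 / s ^ 4) * a ^ 2 := by rw [ht]; ring
              _ ≤ K * (16 / s ^ 4) * (b * |m|) ^ 2 := by gcongr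
              _ = _ := by rw [hB, mul_pow, sq_abs]; ring
          have h5 : Real.exp (B * m ^ 2) ≤ Real.exp (B * (2 * J) ^ 2) :=
            Real.exp_le_exp.2 (mul_le_mul_of_nonneg_left hmJ2 hB0.le)
          have h6 : Real.exp (B * m ^ 2) ≤ 1 + B * m ^ 2 * Real.exp (B * m ^ 2) := by
            have h7 := mul_le_mul_of_nonneg_right (Real.add_one_le_exp (-(B * m ^ 2)))
              (Real.exp_pos (B * m ^ 2)).le
            rw [← Real.exp_add, neg_add_cancel, Real.exp_zero] at h7
            linarith
          calc _ ≤ Real.exp (B * m ^ 2) := Real.exp_le_exp.2 h4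
            _ ≤ 1 + B * m ^ 2 * Real.exp (B * m ^ 2) := h6
            _ ≤ 1 + B * m ^ 2 * Real.exp (B * (2 * J) ^ 2) := by gcongr
            _ = _ := by ring
  have hI1 : Integrable (fun x => 1 + B * Real.exp (B * (2 * J) ^ 2) * (μ' x - μ x) ^ 2)
      (designLaw ν h) := (integrable_const 1).add (hI.const_mul _)
  refine (lintegral_mono key).trans ?_
  rw [← ofReal_integral_eq_lintegral_ofReal hI1
    (Eventually.of_forall fun x => by positivity)]
  refine ENNReal.ofReal_le_ofReal ?_
  rw [integral_add (integrable_const 1) (hI.const_mul _), integral_const_mul]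
  simp only [integral_const, probReal_univ, smul_eq_mul, mul_one]
  linarith [Real.add_one_le_exp
    (B * Real.exp (B * (2 * J) ^ 2) * ∫ x, (μ' x - μ x) ^ 2 ∂designLaw ν h)]

/-! ### Change of measure and the packing argument -/

/-- Integrate `L ≤ L ^ 2 / (4 * q) + q` over `A`; the first term contributes at most 1/4. -/
lemma withDensity_apply_le_of_lintegral_sq_le {Ω : Type*} [MeasurableSpace Ω] {P : Measure Ω}
    {L : Ω → ℝ} (hL : Measurable L) {q : ℝ} (hq : 0 < q)
    (h2 : ∫⁻ d, ENNReal.ofReal (L d ^ 2) ∂P ≤ ENNReal.ofReal q) {A : Set Ω}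
    (hA : MeasurableSet A) :
    P.withDensity (fun d => ENNReal.ofReal (L d)) A ≤ ENNReal.ofReal (1 / 4) +
      ENNReal.ofReal q * P A := by
  rw [withDensity_apply _ hA]
  calc _ ≤ ∫⁻ d in A, (ENNReal.ofReal (1 / (4 * q)) * ENNReal.ofReal (L d ^ 2) +
        ENNReal.ofReal q) ∂P := by
        refine lintegral_mono fun d => ?_
        rw [← ENNReal.ofReal_mul (by positivity), ← ENNReal.ofReal_add (by positivity) hq.le]
        refine ENNReal.ofReal_le_ofReal ?_
        have : 0 ≤ (L d - 2 * q) ^ 2 / (4 * q) := by positivity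
        have e : (L d - 2 * q) ^ 2 / (4 * q) = 1 / (4 * q) * L d ^ 2 + q - L d := by
          field_simp; ring
        linarith
    _ = ENNReal.ofReal (1 / (4 * q)) * ∫⁻ d in A, ENNReal.ofReal (L d ^ 2) ∂P +
        ENNReal.ofReal q * P A := by
        rw [lintegral_add_right _ measurable_const, lintegral_const_mul _ (by fun_prop),
          setLIntegral_const]
    _ ≤ ENNReal.ofReal (1 / (4 * q)) * ENNReal.ofReal q + ENNReal.ofReal q * P A := by
        gcongr
        exact (setLIntegral_le_lintegral _ _).trans h2
    _ = _ := by
        rw [← ENNReal.ofReal_mul (by positivity)]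
        congr 2
        field_simp

lemma sampleLaw_apply_le (h0 : 0 < φ) (h1 : φ < 1) (hs : 0 < s)
    (hh : IsDensity ν h) (hμ : Measurable μ) (hμ' : Measurable μ') (hσ : Measurable σ)
    (hσ0 : ∀ x, 0 < σ x) {r : ℝ}
    (hr : ∫⁻ p, ENNReal.ofReal (likelihoodRatio φ s μ μ' σ p ^ 2) ∂observationLaw ν φ s μ σ h ≤
        ENNReal.ofReal (Real.exp r)) (n : ℕ) {A : Set (Fin n → X × ℝ)} (hA : MeasurableSet A) :
    sampleLaw ν φ s μ' σ h n A ≤ ENNReal.ofReal (1 / 4) +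
      ENNReal.ofReal (Real.exp (n * r)) * sampleLaw ν φ s μ σ h n A := by
  have := isProbabilityMeasure_errorLaw h0 h1 hs
  have := hh.isProbabilityMeasure
  have := isProbabilityMeasure_observationLaw (ν := ν) (h := h) (φ := φ) (s := s) hμ hσ
  have hprob := isProbabilityMeasure_observationLaw (ν := ν) (h := h) (φ := φ) (s := s) hμ' hσ
  have hLm := measurable_likelihoodRatio (φ := φ) (s := s) hμ hμ' hσ
  have hden := observationLaw_eq_withDensity h0 h1 hs hh hμ hμ' hσ hσ0
  have hL0 : ∀ p, 0 ≤ likelihoodRatio φ s μ μ' σ p := fun p => (Real.exp_pos _).le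
  rw [hden] at hprob
  have hpi : sampleLaw ν φ s μ' σ h n = (sampleLaw ν φ s μ σ h n).withDensity
      fun d => ENNReal.ofReal (∏ i, likelihoodRatio φ s μ μ' σ (d i)) := by
    rw [sampleLaw, sampleLaw, hden, pi_withDensity _ n hLm.ennreal_ofReal]
    congr 1
    ext d
    rw [ENNReal.ofReal_prod_of_nonneg fun _ _ => hL0 _]
  rw [hpi]
  refine withDensity_apply_le_of_lintegral_sq_le (by fun_prop) (Real.exp_pos _) ?_ hA
  simp_rw [← Finset.prod_pow]
  simp_rw [ENNReal.ofReal_prod_of_nonneg fun _ _ => sq_nonneg _]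
  rw [sampleLaw, lintegral_pi_prod _ n
    (F := fun _ p => ENNReal.ofReal (likelihoodRatio φ s μ μ' σ p ^ 2)) (fun _ => by fun_prop),
    Finset.prod_const, Finset.card_univ, Fintype.card_fin, Real.exp_nat_mul,
    ENNReal.ofReal_pow (Real.exp_pos _).le]
  exact pow_le_pow_left' hr n

/-- If each of `m` distributions is dominated, up to a factor `q` and a small error, by one of `N`
distributions and `4 q N ≤ m`, then `m` disjoint events cannot all be likely. -/
lemma exists_measure_le_half {Ω ι κ : Type*} [MeasurableSpace Ω] (I : Finset ι) (G : Finset κ)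
    (hI : I.Nonempty) (P : ι → Measure Ω) (Q : κ → Measure Ω)
    [∀ g, IsProbabilityMeasure (Q g)] {A : ι → Set Ω} (hA : ∀ j, MeasurableSet (A j))
    (hdisj : (I : Set ι).PairwiseDisjoint A) {q : ℝ} (hq : 0 ≤ q) {g : ι → κ}
    (hg : ∀ j ∈ I, g j ∈ G)
    (hle : ∀ j ∈ I, P j (A j) ≤ ENNReal.ofReal (1 / 4) + ENNReal.ofReal q * Q (g j) (A j))
    (hcard : 4 * (q * G.card) ≤ I.card) : ∃ j ∈ I, P j (A j) ≤ ENNReal.ofReal (1 / 2) := by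
  by_contra! hcon
  refine absurd (ENNReal.sum_lt_sum_of_nonempty hI hcon) (not_lt.2 ?_)
  have hsum : ∑ j ∈ I, Q (g j) (A j) ≤ G.card := by
    calc _ ≤ ∑ j ∈ I, ∑ k ∈ G, Q k (A j) := Finset.sum_le_sum fun j hj =>
          Finset.single_le_sum (f := fun k => Q k (A j)) (fun _ _ => bot_le) (hg j hj)
      _ = ∑ k ∈ G, ∑ j ∈ I, Q k (A j) := Finset.sum_comm
      -- Under one probability measure the disjoint events have total mass at most 1.
      _ ≤ ∑ k ∈ G, 1 := by
          refine Finset.sum_le_sum fun k _ => ?_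
          rw [← measure_biUnion_finset hdisj fun j _ => hA j]
          exact prob_le_one
      _ = _ := by simp
  calc _ ≤ ∑ j ∈ I, (ENNReal.ofReal (1 / 4) + ENNReal.ofReal q * Q (g j) (A j)) :=
        Finset.sum_le_sum hle
    _ = ENNReal.ofReal (I.card * (1 / 4)) + ENNReal.ofReal q * ∑ j ∈ I, Q (g j) (A j) := by
        rw [Finset.sum_add_distrib, ← Finset.mul_sum, Finset.sum_const, nsmul_eq_mul,
          ENNReal.ofReal_mul (Nat.cast_nonneg _), ENNReal.ofReal_natCast]
    _ ≤ ENNReal.ofReal (I.card * (1 / 4)) + ENNReal.ofReal q * ENNReal.ofReal G.card := by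
        rw [ENNReal.ofReal_natCast]
        gcongr
    _ ≤ ENNReal.ofReal (I.card * (1 / 2)) := by
        rw [← ENNReal.ofReal_mul hq, ← ENNReal.ofReal_add (by positivity) (by positivity)]
        exact ENNReal.ofReal_le_ofReal (by linarith)
    _ = _ := by
        rw [Finset.sum_const, nsmul_eq_mul, ENNReal.ofReal_mul (Nat.cast_nonneg _),
          ENNReal.ofReal_natCast]

lemma measurable_l2Dist [SFinite (designLaw ν h)] {n : ℕ} {est : (Fin n → X × ℝ) → X → ℝ}
    (hest : Measurable (Function.uncurry est)) (hμ : Measurable μ) :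
    Measurable fun d => l2Dist ν h μ (est d) := by
  have h2 : Measurable fun d => l2Dist ν h μ (est d) ^ 2 := by
    simp_rw [l2Dist_sq]
    refine Measurable.lintegral_prod_right' (f := fun p : (Fin n → X × ℝ) × X =>
      ENNReal.ofReal ((est p.1 p.2 - μ p.2) ^ 2)) ?_
    exact ((hest.sub (hμ.comp measurable_snd)).pow_const 2).ennreal_ofReal
  have h3 := h2.pow_const (1 / 2 : ℝ)
  refine (funext fun d => ?_ : (fun d => l2Dist ν h μ (est d)) = _) ▸ h3
  rw [← ENNReal.rpow_natCast, ← ENNReal.rpow_mul]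
  simp

/-- The minimax risk is at least `δ² / 8` once the entropy at `δ` exceeds the entropy at a
radius `ε` by a multiple of `n ε²`. -/
lemma exists_le_minimaxRisk (h0 : 0 < φ) (h1 : φ < 1) (hs : 0 < s)
    {U : Set (X → ℝ)} (hUmeas : ∀ μ ∈ U, Measurable μ)
    (hUbdd : ∃ J : ℝ, ∀ μ ∈ U, ∀ x, |μ x| ≤ J)
    {S : Set (X → ℝ)} (hSne : S.Nonempty) (hSmeas : ∀ σ ∈ S, Measurable σ)
    (hSbdd : ∃ b : ℝ, 1 < b ∧ ∀ σ ∈ S, ∀ x, b⁻¹ ≤ σ x ∧ σ x ≤ b)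
    {H : Set (X → ℝ)} {h₀ : X → ℝ} (hh₀ : h₀ ∈ H) (hd : IsDensity ν h₀)
    (hUtb : IsTotallyBounded ν h₀ U) :
    ∃ K : ℝ, 0 < K ∧ ∀ (ε δ : ℝ) (n : ℕ), 0 < ε → 0 < δ →
      Real.log 4 + packingEntropy ν h₀ U ε + K * (n * ε ^ 2) ≤ packingEntropy ν h₀ U δ →
      ENNReal.ofReal (δ ^ 2 / 8) ≤ minimaxRisk ν φ s U S H n := by
  classical
  obtain ⟨J', hJ'⟩ := hUbdd
  obtain ⟨b, hb, hSb⟩ := hSbdd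
  obtain ⟨σ, hσS⟩ := hSne
  set J := max J' 0
  have hJ0 : 0 ≤ J := le_max_right _ _
  have hJ : ∀ μ ∈ U, ∀ x, |μ x| ≤ J := fun μ hμ x => (hJ' μ hμ x).trans (le_max_left _ _)
  have hb0 : 0 < b := by linarith
  have hσ := hSmeas σ hσS
  have hσ0 : ∀ x, 0 < σ x := fun x => (inv_pos.2 hb0).trans_le (hSb σ hσS x).1
  have := isProbabilityMeasure_errorLaw h0 h1 hs
  have := hd.isProbabilityMeasure
  obtain ⟨K, hK0, hK⟩ := exists_lintegral_likelihoodRatio_sq_le h0 h1 hs hd hJ0 hb0 hσ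
    fun x => (hSb σ hσS x).1
  refine ⟨K, hK0, fun ε δ n hε hδ hent => ?_⟩
  obtain ⟨G, hGU, -, hGcard, hGnet⟩ := exists_maximal_packing hUtb hε
  obtain ⟨I, hIU, hIsep, hIcard, -⟩ := exists_maximal_packing hUtb hδ
  have hEε : packingEntropy ν h₀ U ε = Real.log G.card := by rw [packingEntropy, hGcard]
  have hEδ : packingEntropy ν h₀ U δ = Real.log I.card := by rw [packingEntropy, hIcard]
  rw [hEε, hEδ] at hent
  have hlog4 : 0 < Real.log 4 := Real.log_pos (by norm_num)
  -- An empty packing would have entropy `Real.log 0 = 0`, against the summand `Real.log 4`.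
  have hIpos : 0 < (I.card : ℝ) := by
    rcases Nat.eq_zero_or_pos I.card with h | h
    · rw [h, Nat.cast_zero, Real.log_zero] at hent
      have : 0 ≤ K * (n * ε ^ 2) := by positivity
      linarith [Real.log_natCast_nonneg G.card]
    · exact_mod_cast h
  have hIne : I.Nonempty := Finset.card_pos.1 (by exact_mod_cast hIpos)
  obtain ⟨μ₀, hμ₀⟩ := hIne
  obtain ⟨g₀, hg₀, -⟩ := hGnet μ₀ (hIU hμ₀)
  have hGpos : 0 < (G.card : ℝ) := by exact_mod_cast Finset.card_pos.2 ⟨g₀, hg₀⟩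
  have hcard : 4 * (Real.exp (n * (K * ε ^ 2)) * G.card) ≤ I.card := by
    rw [← Real.log_le_log_iff (by positivity) hIpos, Real.log_mul (by norm_num) (by positivity),
      Real.log_mul (Real.exp_pos _).ne' hGpos.ne', Real.log_exp]
    linarith
  choose! net hnetG hnet using hGnet
  refine le_iInf₂ fun est hest => ?_
  have hestm : ∀ d, Measurable (est d) := fun d => hest.comp measurable_prodMk_left
  -- The event that the estimate is within `δ / 2` of `μ`; these are disjoint along a `δ`-packing.
  -- Taking it empty outside `U` makes it measurable for every `μ`.
  set A : (X → ℝ) → Set (Fin n → X × ℝ) := fun μ =>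
    if μ ∈ U then {d | l2Dist ν h₀ μ (est d) < ENNReal.ofReal (δ / 2)} else ∅ with hA
  have hAU : ∀ μ ∈ U, A μ = {d | l2Dist ν h₀ μ (est d) < ENNReal.ofReal (δ / 2)} :=
    fun μ hμ => if_pos hμ
  have hAm : ∀ μ, MeasurableSet (A μ) := fun μ => by
    by_cases hμ : μ ∈ U
    · rw [hAU μ hμ]
      exact measurableSet_lt (measurable_l2Dist hest (hUmeas μ hμ)) measurable_const
    · rw [hA]; simp [hμ]
  have hdisj : (I : Set (X → ℝ)).PairwiseDisjoint A := fun f hf g hg hfg => by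
    rw [Function.onFun, Set.disjoint_left, hAU f (hIU hf), hAU g (hIU hg)]
    intro d hdf hdg
    have h3 := hIsep hf hg hfg
    have h4 := l2Dist_triangle (ν := ν) (h := h₀) (hUmeas f (hIU hf)) (hestm d)
      (hUmeas g (hIU hg))
    rw [l2Dist_comm (est d)] at h4
    have h5 : ENNReal.ofReal δ = ENNReal.ofReal (δ / 2) + ENNReal.ofReal (δ / 2) := by
      rw [← ENNReal.ofReal_add (by positivity) (by positivity), add_halves]
    rw [h5] at h3
    exact absurd (h3.trans_le h4) (ENNReal.add_lt_add hdf hdg).le.not_gt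
  have hprob : ∀ g : G, IsProbabilityMeasure (sampleLaw ν φ s g σ h₀ n) := fun g => by
    have := isProbabilityMeasure_observationLaw (ν := ν) (h := h₀) (φ := φ) (s := s)
      (hUmeas g (hGU g.2)) hσ
    unfold sampleLaw; infer_instance
  -- The dominating laws are indexed by the subtype of `G`, so that each is a probability measure;
  -- `g₀` is only a default value.
  obtain ⟨μ, hμI, hμ⟩ := exists_measure_le_half I Finset.univ ⟨μ₀, hμ₀⟩
    (fun μ => sampleLaw ν φ s μ σ h₀ n) (fun g : G => sampleLaw ν φ s g σ h₀ n) hAm hdisj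
    (Real.exp_pos (n * (K * ε ^ 2))).le
    (g := fun μ => if hμ : net μ ∈ G then ⟨net μ, hμ⟩ else ⟨g₀, hg₀⟩)
    (fun _ _ => Finset.mem_univ _) (fun μ hμI => by
      have hμU := hIU hμI
      have hgU := hGU (hnetG μ hμU)
      simp only [dif_pos (hnetG μ hμU)]
      refine sampleLaw_apply_le h0 h1 hs hd (hUmeas _ hgU) (hUmeas _ hμU) hσ hσ0 ?_ n (hAm μ)
      refine (hK _ _ (hUmeas _ hgU) (hUmeas _ hμU) (hJ _ hgU) (hJ _ hμU)).trans
        (ENNReal.ofReal_le_ofReal (Real.exp_le_exp.2 (mul_le_mul_of_nonneg_left ?_ hK0.le)))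
      have h3 := pow_le_pow_left' (hnet μ hμU) 2
      rw [l2Dist_comm, l2Dist_sq_eq_ofReal (hUmeas _ hgU) (hUmeas _ hμU) (hJ _ hgU) (hJ _ hμU),
        ← ENNReal.ofReal_pow hε.le] at h3
      exact (ENNReal.ofReal_le_ofReal_iff (by positivity)).1 h3) (by simpa using hcard)
  have hμU := hIU hμI
  have := isProbabilityMeasure_observationLaw (ν := ν) (h := h₀) (φ := φ) (s := s)
    (hUmeas μ hμU) hσ
  have hprobμ : IsProbabilityMeasure (sampleLaw ν φ s μ σ h₀ n) := by
    unfold sampleLaw; infer_instance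
  have hrisk : ENNReal.ofReal (δ ^ 2 / 8) ≤ risk ν φ s μ σ h₀ n est := by
    have hcompl : ENNReal.ofReal (1 / 2) ≤ sampleLaw ν φ s μ σ h₀ n (A μ)ᶜ := by
      rw [prob_compl_eq_one_sub (hAm μ)]
      refine le_trans ?_ (tsub_le_tsub_left hμ 1)
      rw [← ENNReal.ofReal_one, ← ENNReal.ofReal_sub _ (by norm_num)]
      exact ENNReal.ofReal_le_ofReal (by norm_num)
    calc ENNReal.ofReal (δ ^ 2 / 8) = ENNReal.ofReal (δ / 2) ^ 2 * ENNReal.ofReal (1 / 2) := by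
          rw [← ENNReal.ofReal_pow (by positivity), ← ENNReal.ofReal_mul (by positivity)]
          congr 1
          ring
      _ ≤ ENNReal.ofReal (δ / 2) ^ 2 * sampleLaw ν φ s μ σ h₀ n (A μ)ᶜ := by gcongr
      _ = ∫⁻ _ in (A μ)ᶜ, ENNReal.ofReal (δ / 2) ^ 2 ∂sampleLaw ν φ s μ σ h₀ n := by
          rw [setLIntegral_const]
      _ ≤ ∫⁻ d in (A μ)ᶜ, l2Dist ν h₀ μ (est d) ^ 2 ∂sampleLaw ν φ s μ σ h₀ n := by
          refine setLIntegral_mono' (hAm μ).compl fun d hd => ?_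
          rw [hAU μ hμU, Set.mem_compl_iff, Set.mem_ofPred_eq, not_lt] at hd
          exact pow_le_pow_left' hd 2
      _ ≤ _ := setLIntegral_le_lintegral _ _
  exact le_iSup₂_of_le μ hμU (le_iSup₂_of_le σ hσS (le_iSup₂_of_le h₀ hh₀ hrisk))

end LowerBound

/-! ### Growth of the entropy and the critical radius -/

lemma tendsto_const_mul_nhdsGT_zero {c : ℝ} (hc : 0 < c) :
    Tendsto (fun ε : ℝ => c * ε) (𝓝[>] 0) (𝓝[>] 0) := by
  refine tendsto_nhdsWithin_iff.2 ⟨?_, ?_⟩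
  · have : Tendsto (fun ε : ℝ => c * ε) (𝓝 0) (𝓝 (c * 0)) := tendsto_id.const_mul c
    rw [mul_zero] at this
    exact this.mono_left nhdsWithin_le_nhds
  · filter_upwards [self_mem_nhdsWithin] with ε hε
    exact mul_pos hc hε

/-- Absolute values appear because `=Θ` does not see the sign of `M`. Nonvanishing holds since a
ratio with zero denominator is 0, which is below `r`. -/
lemma IsRich.exists_eventually_le {M : ℝ → ℝ} (hM : IsRich M) :
    ∃ α r : ℝ, 0 < α ∧ 1 < r ∧ ∀ᶠ ε in 𝓝[>] 0, M ε ≠ 0 ∧ r * |M ε| ≤ |M (α * ε)| := by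
  obtain ⟨α, hα, -, hlim⟩ := hM
  obtain ⟨r, hr1, hr⟩ := EReal.lt_iff_exists_real_btwn.1 hlim
  have hr1' : (1 : ℝ) < r := by exact_mod_cast hr1
  refine ⟨α, r, hα, hr1', ?_⟩
  filter_upwards [eventually_lt_of_lt_liminf hr] with ε hε
  have hε' : r < M (α * ε) / M ε := by exact_mod_cast hε
  have hne : M ε ≠ 0 := fun h => by
    rw [h, div_zero] at hε'
    linarith
  refine ⟨hne, ?_⟩
  rw [← le_div_iff₀ (abs_pos.2 hne), ← abs_div]
  exact hε'.le.trans (le_abs_self _)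

lemma eventually_pow_mul_le {M : ℝ → ℝ} {α r : ℝ} (hα : 0 < α) (hr : 0 ≤ r)
    (h : ∀ᶠ ε in 𝓝[>] 0, r * |M ε| ≤ |M (α * ε)|) (k : ℕ) :
    ∀ᶠ ε in 𝓝[>] 0, r ^ k * |M ε| ≤ |M (α ^ k * ε)| := by
  induction k with
  | zero => simp
  | succ k ih =>
    filter_upwards [h, (tendsto_const_mul_nhdsGT_zero hα).eventually ih] with ε h1 h2
    rw [← mul_assoc, ← pow_succ] at h2
    calc r ^ (k + 1) * |M ε| = r ^ k * (r * |M ε|) := by ring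
      _ ≤ r ^ k * |M (α * ε)| := by gcongr
      _ ≤ _ := h2

/-- Iterating the growth of `M` gains a factor `r ^ k`, which for large `k` outweighs both `B` and
the two constants of the order relation. -/
lemma exists_eventually_mul_le_of_isRich {M E : ℝ → ℝ} (hM : M =Θ[𝓝[>] 0] E) (hrich : IsRich M)
    (hE : ∀ ε, 0 ≤ E ε) {B : ℝ} (hB : 0 ≤ B) :
    ∃ k : ℝ, 0 < k ∧ ∀ᶠ ε in 𝓝[>] 0, B * E ε ≤ E (k * ε) := by
  obtain ⟨α, r, hα, hr, hgrow⟩ := hrich.exists_eventually_le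
  obtain ⟨a, ha, hMa⟩ := hM.1.exists_pos
  obtain ⟨c, hc, hMc⟩ := hM.2.exists_pos
  obtain ⟨k, hk⟩ := pow_unbounded_of_one_lt (B * c * a) hr
  refine ⟨α ^ k, by positivity, ?_⟩
  filter_upwards [eventually_pow_mul_le hα (by linarith) (hgrow.mono fun _ h => h.2) k, hMc.bound,
    (tendsto_const_mul_nhdsGT_zero (pow_pos hα k)).eventually hMa.bound] with ε h1 h2 h3
  rw [Real.norm_eq_abs, Real.norm_eq_abs, abs_of_nonneg (hE _)] at h2 h3
  have h4 : a * (B * E ε) ≤ a * E (α ^ k * ε) := by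
    calc a * (B * E ε) ≤ a * (B * (c * |M ε|)) := by gcongr
      _ = B * c * a * |M ε| := by ring
      _ ≤ r ^ k * |M ε| := by gcongr
      _ ≤ _ := h1.trans h3
  exact le_of_mul_le_mul_left h4 ha

/-- Richness makes `M` nonzero near 0, so `E` is positive at some radius, and monotonicity extends
the bound to all smaller radii. -/
lemma exists_eventually_le_of_isRich {M E : ℝ → ℝ} (hM : M =Θ[𝓝[>] 0] E) (hrich : IsRich M)
    (hE : ∀ ε, 0 ≤ E ε) (hanti : ∀ ε δ, 0 < ε → ε ≤ δ → E δ ≤ E ε) :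
    ∃ m : ℝ, 0 < m ∧ ∀ᶠ ε in 𝓝[>] 0, m ≤ E ε := by
  obtain ⟨α, r, hα, hr, hgrow⟩ := hrich.exists_eventually_le
  obtain ⟨a, ha, hMa⟩ := hM.1.exists_pos
  obtain ⟨δ, ⟨hne, -⟩, hδ, hδ0⟩ := (hgrow.and (hMa.bound.and self_mem_nhdsWithin)).exists
  refine ⟨E δ, ?_, ?_⟩
  · refine (hE δ).lt_of_ne fun h0 => hne ?_
    rw [← h0, norm_zero, mul_zero] at hδ
    exact norm_le_zero_iff.1 hδ
  · filter_upwards [Ioc_mem_nhdsGT hδ0] with ε hε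
    exact hanti ε δ hε.1 hε.2

/-! ### Rates from the entropy balance -/

lemma sameOrder_of_isTheta {R : ℕ → ℝ≥0∞} {E : ℝ → ℝ} (hE : ∀ ε, 0 ≤ E ε)
    (hup : ∃ K : ℝ, 0 < K ∧ ∀ (ε : ℝ) (n : ℕ), 0 < ε → 0 < n →
      R n ≤ ENNReal.ofReal (K * ((E ε + 1) / n + ε ^ 2)))
    (hlow : ∃ K : ℝ, 0 < K ∧ ∀ (ε δ : ℝ) (n : ℕ), 0 < ε → 0 < δ →
      Real.log 4 + E ε + K * (n * ε ^ 2) ≤ E δ → ENNReal.ofReal (δ ^ 2 / 8) ≤ R n)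
    (hgrow : ∀ B : ℝ, 0 ≤ B → ∃ k : ℝ, 0 < k ∧ ∀ᶠ ε in 𝓝[>] 0, B * E ε ≤ E (k * ε))
    (hpos : ∃ m : ℝ, 0 < m ∧ ∀ᶠ ε in 𝓝[>] 0, m ≤ E ε)
    {ε : ℕ → ℝ} (hε : Tendsto ε atTop (𝓝[>] 0))
    (hΘ : (fun n => E (ε n)) =Θ[atTop] fun n : ℕ => (n : ℝ) * ε n ^ 2) :
    SameOrder R fun n => ε n ^ 2 := by
  obtain ⟨K₁, hK₁, hup⟩ := hup
  obtain ⟨K₂, hK₂, hlow⟩ := hlow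
  obtain ⟨m, hm, hpos⟩ := hpos
  obtain ⟨a, ha, hEa⟩ := hΘ.1.exists_pos
  obtain ⟨c, hc, hEc⟩ := hΘ.2.exists_pos
  have hlog4 : 0 < Real.log 4 := Real.log_pos (by norm_num)
  -- The three summands absorb, as multiples of the entropy, `Real.log 4`, the entropy itself and
  -- the information term `K₂ * (n * ε ^ 2)`.
  obtain ⟨k, hk, hgrow⟩ := hgrow (Real.log 4 / m + 1 + K₂ * c) (by positivity)
  refine ⟨k ^ 2 / 8, K₁ * ((1 + 1 / m) * a + 1), by positivity, by positivity, ?_⟩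
  filter_upwards [hEa.bound, hEc.bound, hε.eventually hpos, hε.eventually hgrow,
    hε.eventually self_mem_nhdsWithin, eventually_gt_atTop 0] with n h1 h2 h3 h4 h5 hn
  have hεn : 0 < ε n := h5
  have hn' : (0 : ℝ) < n := by exact_mod_cast hn
  rw [Real.norm_of_nonneg (hE _), Real.norm_of_nonneg (by positivity)] at h1 h2
  have hone : 1 ≤ E (ε n) / m := (one_le_div hm).2 h3
  constructor
  · have hl := hlow (ε n) (k * ε n) n hεn (by positivity) (le_trans ?_ h4)
    · convert hl using 2
      ring
    · calc Real.log 4 + E (ε n) + K₂ * (n * ε n ^ 2)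
          ≤ Real.log 4 * (E (ε n) / m) + E (ε n) + K₂ * (c * E (ε n)) := by
            gcongr
            exact le_mul_of_one_le_right hlog4.le hone
        _ = _ := by ring
  · refine (hup (ε n) n hεn hn).trans (ENNReal.ofReal_le_ofReal ?_)
    have h6 : (E (ε n) + 1) / n ≤ (1 + 1 / m) * a * ε n ^ 2 := by
      rw [div_le_iff₀ hn']
      calc E (ε n) + 1 ≤ E (ε n) + E (ε n) / m := by gcongr
        _ = (1 + 1 / m) * E (ε n) := by ring
        _ ≤ (1 + 1 / m) * (a * (n * ε n ^ 2)) := by gcongr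
        _ = _ := by ring
    calc _ ≤ K₁ * ((1 + 1 / m) * a * ε n ^ 2 + ε n ^ 2) := by gcongr
      _ = _ := by ring

/-- If `ε n ≥ η`, then `n * η ^ 2 ≤ E (ε n) ≤ E η`, which fails for large `n`. -/
lemma tendsto_of_eq_mul_sq {E : ℝ → ℝ} (hanti : ∀ ε δ, 0 < ε → ε ≤ δ → E δ ≤ E ε)
    {ε : ℕ → ℝ} (hε : ∀ᶠ n : ℕ in atTop, 0 < ε n ∧ E (ε n) = n * ε n ^ 2) :
    Tendsto ε atTop (𝓝[>] 0) := by
  refine tendsto_nhdsWithin_iff.2 ⟨?_, hε.mono fun n h => h.1⟩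
  rw [tendsto_order]
  refine ⟨fun a ha => hε.mono fun n h => ha.trans h.1, fun η hη => ?_⟩
  obtain ⟨n₀, hn₀⟩ := exists_nat_gt (E η / η ^ 2)
  filter_upwards [hε, eventually_ge_atTop n₀] with n h hn
  by_contra! hcon
  have h1 := hanti η (ε n) hη hcon
  rw [h.2] at h1
  have h2 : E η < n * η ^ 2 := by
    rw [← div_lt_iff₀ (by positivity)]
    exact hn₀.trans_le (by exact_mod_cast hn)
  have h3 : (n : ℝ) * η ^ 2 ≤ n * ε n ^ 2 := by gcongr
  linarith

/-- Every fixed radius is eventually admissible, so the infimum tends to 0. Near 0 the entropy is at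
least `m`, so small admissible radii are at least `√(m / n)` and the infimum is positive. -/
lemma tendsto_criticalRadius {E : ℝ → ℝ}
    (hpos : ∃ m : ℝ, 0 < m ∧ ∀ᶠ ε in 𝓝[>] 0, m ≤ E ε) :
    Tendsto (criticalRadius E) atTop (𝓝[>] 0) := by
  obtain ⟨m, hm, hpos⟩ := hpos
  obtain ⟨η, hη, hηE⟩ := (mem_nhdsGT_iff_exists_Ioc_subset).1 hpos
  have hη0 : 0 < η := hη
  have hbdd : ∀ n : ℕ, BddBelow {ε : ℝ | 0 < ε ∧ E ε ≤ n * ε ^ 2} := fun n => ⟨0, fun ε h => h.1.le⟩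
  have hmem : ∀ δ : ℝ, 0 < δ → ∀ᶠ n : ℕ in atTop, δ ∈ {ε : ℝ | 0 < ε ∧ E ε ≤ n * ε ^ 2} := by
    intro δ hδ
    obtain ⟨n₀, hn₀⟩ := exists_nat_gt (E δ / δ ^ 2)
    filter_upwards [eventually_ge_atTop n₀] with n hn
    refine ⟨hδ, ?_⟩
    rw [← div_le_iff₀ (by positivity)]
    exact hn₀.le.trans (by exact_mod_cast hn)
  have hposr : ∀ᶠ n : ℕ in atTop, 0 < criticalRadius E n := by
    filter_upwards [hmem 1 one_pos, eventually_gt_atTop 0] with n h1 hn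
    have hn' : (0 : ℝ) < n := by exact_mod_cast hn
    refine (show 0 < min η (Real.sqrt (m / n)) by positivity).trans_le
      (le_csInf ⟨1, h1⟩ fun ε hε => ?_)
    rcases le_or_gt ε η with h | h
    · refine (min_le_right _ _).trans (Real.sqrt_le_iff.2 ⟨hε.1.le, ?_⟩)
      rw [div_le_iff₀ hn', mul_comm]
      exact (hηE ⟨hε.1, h⟩).trans hε.2
    · exact (min_le_left _ _).trans h.le
  refine tendsto_nhdsWithin_iff.2 ⟨?_, hposr⟩
  rw [tendsto_order]
  refine ⟨fun a ha => hposr.mono fun n h => ha.trans h, fun a ha => ?_⟩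
  filter_upwards [hmem (a / 2) (half_pos ha)] with n hn
  exact (csInf_le (hbdd n) hn).trans_lt (half_lt_self ha)

/-- The infimum `r` itself may fail to be admissible. But `2 * r` lies above an admissible radius
and `r / 2` is not admissible, which bounds `E (2 * r)` above and `E (r / 2)` below; regularity
compares the two values. -/
lemma isTheta_two_mul_criticalRadius {E : ℝ → ℝ} (hE : ∀ ε, 0 ≤ E ε)
    (hanti : ∀ ε δ, 0 < ε → ε ≤ δ → E δ ≤ E ε)
    (hpos : ∃ m : ℝ, 0 < m ∧ ∀ᶠ ε in 𝓝[>] 0, m ≤ E ε)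
    (hreg : (fun ε => E (1 / 4 * ε)) =O[𝓝[>] 0] E) :
    (fun n => E (2 * criticalRadius E n)) =Θ[atTop]
      fun n : ℕ => (n : ℝ) * (2 * criticalRadius E n) ^ 2 := by
  have ht := tendsto_criticalRadius hpos
  have ht2 := (tendsto_const_mul_nhdsGT_zero two_pos).comp ht
  obtain ⟨B, hB, hEB⟩ := hreg.exists_pos
  refine ⟨IsBigO.of_bound 1 ?_, IsBigO.of_bound (16 * B) ?_⟩
  · filter_upwards [ht.eventually self_mem_nhdsWithin, eventually_gt_atTop 0] with n hr hn
    have hr0 : 0 < criticalRadius E n := hr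
    -- The infimum of the empty set is 0 by convention, which the positive radius excludes.
    have hne : {ε : ℝ | 0 < ε ∧ E ε ≤ n * ε ^ 2}.Nonempty := by
      by_contra hcon
      rw [Set.not_nonempty_iff_eq_empty] at hcon
      rw [criticalRadius, hcon, Real.sInf_empty] at hr0
      exact lt_irrefl _ hr0
    obtain ⟨ε, hε, hlt⟩ := exists_lt_of_csInf_lt hne
      (show criticalRadius E n < 2 * criticalRadius E n by linarith)
    rw [Real.norm_of_nonneg (hE _), Real.norm_of_nonneg (by positivity), one_mul]
    have hε0 := hε.1
    calc E (2 * criticalRadius E n) ≤ E ε := hanti _ _ hε.1 hlt.le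
      _ ≤ n * ε ^ 2 := hε.2
      _ ≤ _ := by gcongr
  · filter_upwards [ht.eventually self_mem_nhdsWithin, ht2.eventually hEB.bound] with n hr h1
    have hr0 : 0 < criticalRadius E n := hr
    have hnot := notMem_of_lt_csInf
      (show criticalRadius E n / 2 < criticalRadius E n from half_lt_self hr0)
      (show BddBelow {ε : ℝ | 0 < ε ∧ E ε ≤ n * ε ^ 2} from ⟨0, fun ε h => h.1.le⟩)
    have h2 : n * (criticalRadius E n / 2) ^ 2 < E (criticalRadius E n / 2) := by
      by_contra! hcon
      exact hnot ⟨by positivity, hcon⟩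
    simp only [Function.comp_apply] at h1
    rw [Real.norm_of_nonneg (hE _), Real.norm_of_nonneg (hE _),
      show 1 / 4 * (2 * criticalRadius E n) = criticalRadius E n / 2 by ring] at h1
    rw [Real.norm_of_nonneg (hE _), Real.norm_of_nonneg (by positivity)]
    calc _ = 16 * (n * (criticalRadius E n / 2) ^ 2) := by ring
      _ ≤ 16 * (B * E (2 * criticalRadius E n)) := by linarith
      _ = _ := by ring

lemma SameOrder.of_const_mul_sq {R : ℕ → ℝ≥0∞} {k : ℝ} (hk : 0 < k) {r : ℕ → ℝ}
    (h : SameOrder R fun n => (k * r n) ^ 2) : SameOrder R fun n => r n ^ 2 := by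
  obtain ⟨c, C, hc, hC, h⟩ := h
  refine ⟨c * k ^ 2, C * k ^ 2, by positivity, by positivity, h.mono fun n hn => ?_⟩
  simpa only [mul_pow, mul_assoc] using hn

end ExpectileMinimax

end

/-! ### The expectile property and the three forms of the rate -/

open ExpectileMinimax
theorem corollary2 {X : Type*} [MeasurableSpace X] (ν : Measure X) [SigmaFinite ν]
    -- the asymmetric normal error with location 0, skewness φ and scale s
    (φ s : ℝ) (hφ₀ : 0 < φ) (hφ₁ : φ < 1) (hs : 0 < s)
    -- the regression functions
    (U : Set (X → ℝ)) (hUmeas : ∀ μ ∈ U, Measurable μ)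
    (hUbdd : ∃ J : ℝ, ∀ μ ∈ U, ∀ x, |μ x| ≤ J)
    -- the scale functions
    (S : Set (X → ℝ)) (hSne : S.Nonempty) (hSmeas : ∀ σ ∈ S, Measurable σ)
    (hSbdd : ∃ b : ℝ, 1 < b ∧ ∀ σ ∈ S, ∀ x, b⁻¹ ≤ σ x ∧ σ x ≤ b)
    -- the covariate densities, with a dominating member
    (H : Set (X → ℝ)) (hH : ∀ h ∈ H, IsDensity ν h)
    (h₀ : X → ℝ) (hh₀ : h₀ ∈ H) (hdom : ∃ C : ℝ, ∀ h ∈ H, ∀ᵐ x ∂ν, h x ≤ C * h₀ x)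
    -- the entropy conditions
    (hUtb : IsTotallyBounded ν h₀ U) (hStb : IsTotallyBounded ν h₀ S)
    (M : ℝ → ℝ) (hM : M =Θ[𝓝[>] 0] packingEntropy ν h₀ U)
    (hrich : IsRich M) (hreg : IsOrderRegular M)
    (hSU : packingEntropy ν h₀ S =O[𝓝[>] 0] packingEntropy ν h₀ U) :
    -- the regression function is the conditional expectile of the response
    (∀ μ ∈ U, ∀ σ ∈ S, ∀ x z, IsExpectile φ (responseLaw φ s μ σ x) z ↔ z = μ x) ∧
    -- the rate, with the radius solving the equation for the packing entropy itself
    (∀ ε : ℕ → ℝ,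
      (∀ᶠ n : ℕ in atTop, 0 < ε n ∧ packingEntropy ν h₀ U (ε n) = n * ε n ^ 2) →
      SameOrder (minimaxRisk ν φ s U S H) fun n => ε n ^ 2) ∧
    -- the rate, with the crossing point when the packing entropy jumps over the equation
    SameOrder (minimaxRisk ν φ s U S H)
      (fun n => criticalRadius (packingEntropy ν h₀ U) n ^ 2) ∧
    -- the rate, with the radius solving the equation (in order) for the known entropy order
    (∀ ε : ℕ → ℝ, Tendsto ε atTop (𝓝[>] 0) →
      ((fun n : ℕ => M (ε n)) =Θ[atTop] fun n : ℕ => (n : ℝ) * ε n ^ 2) →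
      SameOrder (minimaxRisk ν φ s U S H) fun n => ε n ^ 2) := by
  have hE : ∀ ε, 0 ≤ packingEntropy ν h₀ U ε := fun ε => Real.log_natCast_nonneg _
  have hanti : ∀ ε δ, 0 < ε → ε ≤ δ → packingEntropy ν h₀ U δ ≤ packingEntropy ν h₀ U ε :=
    fun ε δ => packingEntropy_le_of_le hUtb
  have hpos := exists_eventually_le_of_isRich hM hrich hE hanti
  have core : ∀ {ε : ℕ → ℝ}, Tendsto ε atTop (𝓝[>] 0) →
      ((fun n => packingEntropy ν h₀ U (ε n)) =Θ[atTop] fun n : ℕ => (n : ℝ) * ε n ^ 2) →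
      SameOrder (minimaxRisk ν φ s U S H) fun n => ε n ^ 2 := fun hε hΘ =>
    sameOrder_of_isTheta hE
      (exists_minimaxRisk_le hφ₀ hφ₁ hs hUmeas hUbdd hSmeas hSbdd hH hh₀ hdom hUtb)
      (exists_le_minimaxRisk hφ₀ hφ₁ hs hUmeas hUbdd hSne hSmeas hSbdd hh₀ (hH h₀ hh₀) hUtb)
      (fun B hB => exists_eventually_mul_le_of_isRich hM hrich hE hB) hpos hε hΘ
  refine ⟨fun μ hμ σ hσ x z => ?_, fun ε hε => ?_, ?_, fun ε hε hΘ => ?_⟩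
  · obtain ⟨b, hb, hSb⟩ := hSbdd
    exact isExpectile_responseLaw_iff hφ₀ hφ₁ hs
      ((inv_pos.2 (by linarith)).trans_le (hSb σ hσ x).1) z
  · exact core (tendsto_of_eq_mul_sq hanti hε)
      (EventuallyEq.isTheta (hε.mono fun n h => h.2))
  · have hquarter : (0 : ℝ) < 1 / 4 := by norm_num
    -- Regularity passes from `M` to the packing entropy through their common order.
    have hregE : (fun ε => packingEntropy ν h₀ U (1 / 4 * ε)) =O[𝓝[>] 0]
        packingEntropy ν h₀ U :=
      ((hM.2.comp_tendsto (tendsto_const_mul_nhdsGT_zero hquarter)).trans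
        (hreg (1 / 4) hquarter).2).trans hM.1
    exact SameOrder.of_const_mul_sq two_pos
      (core ((tendsto_const_mul_nhdsGT_zero two_pos).comp (tendsto_criticalRadius hpos))
        (isTheta_two_mul_criticalRadius hE hanti hpos hregE))
  · have hcomp : (fun n => M (ε n)) =Θ[atTop] fun n => packingEntropy ν h₀ U (ε n) :=
      ⟨hM.1.comp_tendsto hε, hM.2.comp_tendsto hε⟩
    exact core hε (hcomp.symm.trans hΘ)
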